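/- \textbf{Model.} Let $M\in\mathbb{N}$, $\alpha>2$, $\delta>0$, $P_D>0$, $\sigma^2\ge 0$ and, for $i=1,\dots,M$, let $\lambda_{D_i}>0$ and $p_{t_i},p_{f_i}\in[0,1]$. For each $i$ let the potential D2D transmitters of type $i$ form a homogeneous Poisson point process $\Phi_{D_i}$ of density $\lambda_{D_i}$ in $\mathbb{R}^2$. Each transmitter has its own receiver, displaced from it by a centred Gaussian vector of $\mathbb{R}^2$ with independent coordinates of variance $\delta^2$. In the time slot and on the subband under consideration, a link (transmitter and receiver) of type $i$ is in D2D mode with probability $p_{t_i}$ and accesses the subband with probability $p_{f_i}$; it is active if both happen. The power fading coefficient $h_{k,l}$ from the transmitter of a link $k$ to the receiver of a link $l$ is exponential with mean $1$. The point processes, and all hopping decisions, displacements and fading coefficients, are mutually independent. Write $x_k$ and $y_k$ for the transmitter and receiver of link $k$. For a link $l$ let \[ I_l=\sum_{k\ne l,\ k\text{ active}}P_D\,h_{k,l}\,|x_k-y_l|^{-\alpha},\qquad \mathrm{SINR}_l=\frac{P_D\,h_{l,l}\,|x_l-y_l|^{-\alpha}}{I_l+\sigma^2} \] (dedicated network: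 there is no interference from base stations; $\mathrm{SINR}_l=\infty$ if $I_l+\sigma^2=0$). Put $\tilde\lambda_D=\sum_{i=1}^M p_{t_i}p_{f_i}\lambda_{D_i}$ and assume $\tilde\lambda_D>0$. Expectations at the typical active link, that is, under the Palm distribution given an active receiver at the origin, are \[ \mathbb{E}^0[Z]=\frac{\mathbb{E}\sum_{l\text{ active},\,y_l\in A}Z_l}{\mathbb{E}\,\#\{l\text{ active}: y_l\in A\}} \] for translation-invariant $Z_l\ge 0$, where $A\subset\mathbb{R}^2$ is any Borel set with $0<|A|<\infty$. Let $\mathbb{P}_D^{(O)}(\beta)=\mathbb{E}^0[\mathbf 1\{\mathrm{SINR}>\beta\}]$ be the coverage probability and $\mathcal{L}_{I_D}(s)=\mathbb{E}^0[e^{-sI}]$ the Laplace transform of the interference. \textbf{Proposition (SINR distribution of D2D links in the dedicated network).} For every such $A$, for all $\beta>0$, \[ \mathbb{P}_D^{(O)}(\beta)=\int_0^\infty e^{-\beta P_D^{-1}\sigma^2v^\alpha}\,\mathcal{L}_{I_D}\!\left(\beta P_D^{-1}v^\alpha\right)\frac{v}{\delta^2}e^{-\frac{v^2}{2\delta^2}}\,dv,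 \] and, for all $s\ge 0$, \[ \mathcal{L}_{I_D}(s)=\exp\left(-\tilde\lambda_D\,\frac{2\pi^2/\alpha}{\sin(2\pi/\alpha)}\,(sP_D)^{2/\alpha}\right). \] -/

import Mathlib

open MeasureTheory ProbabilityTheory
open scoped ENNReal

noncomputable section

namespace D2D

/-- The Euclidean plane. -/
abbrev Plane : Type := EuclideanSpace ℝ (Fin 2)

/-- The number of points of the (enumerated) point configuration `X · ω` that lie in `B`. -/
def count {Ω : Type*} (X : ℕ → Ω → Plane) (B : Set Plane) (ω : Ω) : ℕ∞ :=
  Set.encard {n : ℕ | X n ω ∈ B}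

/-- The random points `X 0, X 1, …` form a homogeneous Poisson point process on the plane with
density `lam` (points per unit area): the number of points in a Borel set `B` of finite area is
Poisson with mean `lam * |B|`, and the numbers of points in disjoint Borel sets are independent.
For `lam > 0` such a process has infinitely many points almost surely, so that enumerating
them by `ℕ` loses nothing; the enumeration itself is arbitrary. -/
structure IsHomogeneousPoissonProcess {Ω : Type*} [MeasurableSpace Ω]
    (X : ℕ → Ω → Plane) (lam : ℝ) (μ : Measure Ω) : Prop where
  measurable_point : ∀ n, Measurable (X n)
  count_law : ∀ B : Set Plane, MeasurableSet B → volume B ≠ ∞ → ∀ k : ℕ,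
    μ {ω | count X B ω = k} = poissonMeasure (ENNReal.ofReal lam * volume B).toNNReal {k}
  count_indep : ∀ (m : ℕ) (B : Fin m → Set Plane), (∀ j, MeasurableSet (B j)) →
    Pairwise (fun i j => Disjoint (B i) (B j)) → iIndepFun (fun j => count X (B j)) μ

/-- A D2D link: its type `i`, and the index `n` of its transmitter in the process of type `i`. -/
abbrev Link (M : ℕ) : Type := Fin M × ℕ

/-- The random elements of a network of D2D links with `M` types, seen in one time slot and on
one subband. -/
structure Network (M : ℕ) (Ω : Type*) where
  /-- `tx i n` is the location of the `n`-th potential transmitter of type `i`. -/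
  tx : Fin M → ℕ → Ω → Plane
  /-- whether the link is in D2D mode in the time slot -/
  timeHop : Link M → Ω → Bool
  /-- whether the link accesses the subband -/
  freqHop : Link M → Ω → Bool
  /-- the displacement from the transmitter of the link to its receiver -/
  offset : Link M → Ω → Plane
  /-- `fading k l` is the power fading coefficient of the channel from the transmitter of the
  link `k` to the receiver of the link `l`. -/
  fading : Link M → Link M → Ω → ℝ

/-- Names of the sources of randomness: the transmitter process of a type, and the
individual hopping decisions, displacements and fading coefficients. -/
inductive Source (M : ℕ) : Type
  | points (i : Fin M)
  | timeHop (k : Link M)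
  | freqHop (k : Link M)
  | offset (k : Link M)
  | fading (k l : Link M)

namespace Network

variable {M : ℕ} {Ω : Type*}

/-- The σ-algebra that a source of randomness generates on the sample space. -/
@[reducible] def sigma (N : Network M Ω) : Source M → MeasurableSpace Ω
  | .points i => MeasurableSpace.comap (fun ω n => N.tx i n ω) inferInstance
  | .timeHop k => MeasurableSpace.comap (N.timeHop k) inferInstance
  | .freqHop k => MeasurableSpace.comap (N.freqHop k) inferInstance
  | .offset k => MeasurableSpace.comap (N.offset k) inferInstance
  | .fading k l => MeasurableSpace.comap (N.fading k l) inferInstance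

/-- The probabilistic model: the transmitters of type `i` form a homogeneous Poisson process of
density `lam i`; a link of type `i` is in D2D mode with probability `pt i` and accesses the
subband with probability `pf i`; the displacement from a transmitter to its receiver is a centred
Gaussian vector of the plane whose coordinates are independent with variance `δ ^ 2`; all fading
coefficients are exponential with mean `1` (Rayleigh fading); and all of these are
independent. -/
structure IsModel [MeasurableSpace Ω] (N : Network M Ω) (lam pt pf : Fin M → ℝ) (δ : ℝ)
    (μ : Measure Ω) : Prop where
  poisson : ∀ i, IsHomogeneousPoissonProcess (N.tx i) (lam i) μ
  measurable_timeHop : ∀ k, Measurable (N.timeHop k)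
  timeHop_law : ∀ k, μ {ω | N.timeHop k ω = true} = ENNReal.ofReal (pt k.1)
  measurable_freqHop : ∀ k, Measurable (N.freqHop k)
  freqHop_law : ∀ k, μ {ω | N.freqHop k ω = true} = ENNReal.ofReal (pf k.1)
  measurable_offset : ∀ k, Measurable (N.offset k)
  offset_law : ∀ k, μ.map (N.offset k) = (stdGaussian Plane).map (fun x => δ • x)
  measurable_fading : ∀ k l, Measurable (N.fading k l)
  fading_law : ∀ k l, μ.map (N.fading k l) = expMeasure 1
  indep : iIndep N.sigma μ

/-- The transmitter of the link `k`. -/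
def txOf (N : Network M Ω) (k : Link M) (ω : Ω) : Plane := N.tx k.1 k.2 ω

/-- The receiver of the link `k`. -/
def rxOf (N : Network M Ω) (k : Link M) (ω : Ω) : Plane := N.txOf k ω + N.offset k ω

/-- The link `k` transmits on the resource block that is considered. -/
def Active (N : Network M Ω) (k : Link M) (ω : Ω) : Prop :=
  N.timeHop k ω = true ∧ N.freqHop k ω = true

/-- The power received from the transmitter of `k` at the receiver of `l`, for the transmit
power `P` and the path loss function `d ↦ d ^ (-α)`. -/
def rxPower (N : Network M Ω) (P α : ℝ) (k l : Link M) (ω : Ω) : ℝ≥0∞ :=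
  ENNReal.ofReal P * ENNReal.ofReal (N.fading k l ω) * ‖N.txOf k ω - N.rxOf l ω‖ₑ ^ (-α)

open Classical in
/-- The interference at the receiver of the link `l`: the power received from the
transmitters of all the other active links. -/
def interference (N : Network M Ω) (P α : ℝ) (l : Link M) (ω : Ω) : ℝ≥0∞ :=
  ∑' k : Link M, if k ≠ l ∧ N.Active k ω then N.rxPower P α k l ω else 0

/-- The signal-to-interference-plus-noise ratio of the link `l`, with noise power `noise`; it is
`∞` when interference and noise both vanish. -/
def sinr (N : Network M Ω) (P α noise : ℝ) (l : Link M) (ω : Ω) : ℝ≥0∞ :=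
  N.rxPower P α l l ω / (N.interference P α l ω + ENNReal.ofReal noise)

open Classical in
/-- The sum of `Z` over the active links whose receiver lies in the window `A`. -/
def windowSum (N : Network M Ω) (A : Set Plane) (Z : Link M → Ω → ℝ≥0∞) (ω : Ω) : ℝ≥0∞ :=
  ∑' l : Link M, if N.Active l ω ∧ N.rxOf l ω ∈ A then Z l ω else 0

/-- The expectation of `Z` at the typical active link, that is, under the Palm distribution of the
stationary network for an active receiver at the origin: the mean of the sum of `Z` over
the active links with receiver in the window `A`, divided by the mean number of such links. The
quantities `Z` used below depend on the locations only through their differences. -/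
def typicalMean [MeasurableSpace Ω] (N : Network M Ω) (μ : Measure Ω) (A : Set Plane)
    (Z : Link M → Ω → ℝ≥0∞) : ℝ≥0∞ :=
  (∫⁻ ω, N.windowSum A Z ω ∂μ) / ∫⁻ ω, N.windowSum A (fun _ _ => 1) ω ∂μ

open Classical in
/-- The coverage probability: the probability that the SINR of the typical active link exceeds
the threshold `β`. -/
def coverageProb [MeasurableSpace Ω] (N : Network M Ω) (μ : Measure Ω) (A : Set Plane)
    (P α noise β : ℝ) : ℝ≥0∞ :=
  N.typicalMean μ A (fun l ω => if ENNReal.ofReal β < N.sinr P α noise l ω then 1 else 0)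

/-- The Laplace transform at `s` of the interference `I` at the receiver of the typical active
link, the mean of `exp (-s I)` (with `exp (-∞) = 0`). -/
def interferenceLaplace [MeasurableSpace Ω] (N : Network M Ω) (μ : Measure Ω) (A : Set Plane)
    (P α s : ℝ) : ℝ≥0∞ :=
  N.typicalMean μ A
    (fun l ω => EReal.exp (-((ENNReal.ofReal s * N.interference P α l ω : ℝ≥0∞) : EReal)))

end Network

end D2D

end

noncomputable section

namespace D2D

open Filter Topology

/-! Both quantities of the theorem, and the normalising denominator, reduce to means of `∑ w(o_l)
exp (-s(o_l) I_l)` over the active links `l` with receiver in `A`, where `o_l` is the displacement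
of the receiver. The Laplace transform has `w = 1` and `s` constant; the denominator has `w = 1`, `s
= 0`. For the coverage probability, `SINR > β` means `h_{l,l} > β P⁻¹ |o_l|^α (I_l + σ²)`. Since
`h_{l,l}` is exponential and independent of the rest, the indicator averages to `exp` of minus the
right side (`IsModel.coverage_link`), so `s(z) = β P⁻¹ |z|^α` and `w = exp (-s σ²)`.

Such a sum is computed in three steps. Given all locations, averaging over hopping and fading turns
`exp (-s I_l)` into a product of one `linkFactor` per link `k ≠ l`, while the activity of `l`
contributes its probability (`IsModel.laplace_link`). The displacement is independent of the
transmitters and can be frozen at a value `z`. Mecke's formula and translation invariance then yield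
the density of active links times `|A|` times the generating functional of the whole process
(`IsModel.mecke_removed`, `IsModel.lintegral_windowSum`). The prefactor cancels in the ratio, which
is why `A` does not matter. The generating functional is explicit, because `1 - linkFactor`
integrates over the plane to a constant times `t ^ (2 / α)` (polar coordinates and the reflection
formula for `Γ`). The length of the Gaussian displacement has the Rayleigh law, which gives the
outer integral.

The points are enumerated arbitrarily and only their counts are known. Therefore the generating
functional is first derived from the counts (`IsHomogeneousPoissonProcess.pgfl`), and Mecke's
formula is obtained by differentiating it in the direction of an indicator
(`HasPoissonPGFL.mecke_indicator`). Working in `[0, ∞]` removes all questions of summability and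
allows infinite exponents, that is, vanishing factors. -/

/-! ### The function `a ↦ exp (-a)` on `[0, ∞]` -/

/-- The function `a ↦ exp (-a)` on `[0, ∞]`, with `exp (-∞) = 0`. -/
def expNeg (a : ℝ≥0∞) : ℝ≥0∞ := EReal.exp (-(a : EReal))

lemma expNeg_eq_inv (a : ℝ≥0∞) : expNeg a = (EReal.exp (a : EReal))⁻¹ := EReal.exp_neg _

@[simp] lemma expNeg_zero : expNeg 0 = 1 := by simp [expNeg]

@[simp] lemma expNeg_top : expNeg ∞ = 0 := by simp [expNeg]

lemma expNeg_antitone : Antitone expNeg := fun a b h => by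
  unfold expNeg
  apply EReal.exp_monotone
  rw [EReal.neg_le_neg_iff]
  exact_mod_cast h

lemma expNeg_le_one (a : ℝ≥0∞) : expNeg a ≤ 1 := by
  simpa using expNeg_antitone (bot_le : ⊥ ≤ a)

lemma expNeg_ne_top (a : ℝ≥0∞) : expNeg a ≠ ∞ :=
  ((expNeg_le_one a).trans_lt ENNReal.one_lt_top).ne

lemma expNeg_ofReal {r : ℝ} (hr : 0 ≤ r) : expNeg (ENNReal.ofReal r) =
    ENNReal.ofReal (Real.exp (-r)) := by
  rw [expNeg, EReal.coe_ennreal_ofReal, max_eq_left hr, ← EReal.coe_neg, EReal.exp_coe]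

lemma expNeg_eq_ofReal {a : ℝ≥0∞} (ha : a ≠ ∞) :
    expNeg a = ENNReal.ofReal (Real.exp (-a.toReal)) := by
  rw [← expNeg_ofReal ENNReal.toReal_nonneg, ENNReal.ofReal_toReal ha]

lemma expNeg_ne_zero {a : ℝ≥0∞} (ha : a ≠ ∞) : expNeg a ≠ 0 := by
  rw [expNeg_eq_ofReal ha]
  simp [Real.exp_pos]

lemma expNeg_add (a b : ℝ≥0∞) : expNeg (a + b) = expNeg a * expNeg b := by
  simp only [expNeg_eq_inv, EReal.coe_ennreal_add, EReal.exp_add]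
  apply ENNReal.mul_inv
  · left; simp
  · right; simp

lemma continuous_expNeg : Continuous expNeg :=
  ENNReal.continuous_exp.comp (continuous_neg.comp continuous_coe_ennreal_ereal)

@[fun_prop] lemma measurable_expNeg : Measurable expNeg := continuous_expNeg.measurable

lemma expNeg_sum {ι : Type*} (s : Finset ι) (a : ι → ℝ≥0∞) :
    expNeg (∑ k ∈ s, a k) = ∏ k ∈ s, expNeg (a k) := by
  classical
  induction s using Finset.induction_on with
  | empty => simp
  | insert k s hk ih => rw [Finset.sum_insert hk, Finset.prod_insert hk, expNeg_add, ih]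

lemma tendsto_expNeg_sum {ι : Type*} (a : ι → ℝ≥0∞) :
    Tendsto (fun s : Finset ι => ∏ k ∈ s, expNeg (a k)) atTop (𝓝 (expNeg (∑' k, a k))) := by
  have h := (continuous_expNeg.tendsto _).comp (ENNReal.summable (f := a)).hasSum
  simpa only [Function.comp_def, expNeg_sum, SummationFilter.unconditional_filter] using h

/-- The inverse function of `expNeg`. -/
def negLog (g : ℝ≥0∞) : ℝ≥0∞ := (-(ENNReal.log g)).toENNReal

/-- Any factor in `[0, 1]`, zero included, can thus be written with an exponent in `[0, ∞]`, the
form in which generating functionals are stated. -/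
lemma expNeg_negLog {g : ℝ≥0∞} (hg : g ≤ 1) : expNeg (negLog g) = g := by
  rw [expNeg, negLog, EReal.coe_toENNReal, neg_neg, ENNReal.exp_log]
  rw [EReal.neg_nonneg]
  have := ENNReal.log_monotone hg
  simpa using this

lemma continuous_negLog : Continuous negLog :=
  EReal.continuous_toENNReal.comp (continuous_neg.comp ENNReal.continuous_log)

@[fun_prop] lemma measurable_negLog : Measurable negLog := continuous_negLog.measurable

lemma negLog_antitone : Antitone negLog := fun a b h => by
  apply EReal.toENNReal_le_toENNReal
  rw [EReal.neg_le_neg_iff]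
  exact ENNReal.log_monotone h

lemma negLog_ne_top {g : ℝ≥0∞} (hg : g ≠ 0) : negLog g ≠ ∞ := by
  simp [negLog, EReal.neg_eq_top_iff, hg]

/-! ### A difference quotient of `expNeg` -/

/-- The difference quotient of `t ↦ 1 - exp (-t a)` on `[0, 2⁻ᵐ]`. -/
def expQuot (m : ℕ) (a : ℝ≥0∞) : ℝ≥0∞ := 2 ^ m * (1 - expNeg ((2 ^ m)⁻¹ * a))

/-- With `q = exp (-a / 2 ^ (m + 1))` this is `1 - q ^ 2 ≤ 2 * (1 - q)`. Monotonicity along dyadic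
steps lets the derivative pass under the expectation by monotone convergence. -/
lemma expQuot_le_succ (m : ℕ) (a : ℝ≥0∞) : expQuot m a ≤ expQuot (m + 1) a := by
  unfold expQuot
  have h2 : ((2 : ℝ≥0∞) ^ m)⁻¹ * a = (2 ^ (m + 1))⁻¹ * a + (2 ^ (m + 1))⁻¹ * a := by
    rw [← add_mul, pow_succ, ENNReal.mul_inv (by simp) (by simp), ← mul_add, ENNReal.inv_two_add_inv_two,
      mul_one]
  rw [h2, expNeg_add]
  set q := expNeg ((2 ^ (m + 1))⁻¹ * a)
  rw [pow_succ, mul_assoc]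
  gcongr
  have hq : q ≤ 1 := expNeg_le_one _
  rw [tsub_le_iff_right, two_mul]
  calc (1 : ℝ≥0∞) = (1 - q) + q * 1 := by rw [mul_one, tsub_add_cancel_of_le hq]
    _ = (1 - q) + q * ((1 - q) + q) := by rw [tsub_add_cancel_of_le hq]
    _ = (1 - q) + (q * (1 - q) + q * q) := by rw [mul_add]
    _ ≤ (1 - q) + (1 * (1 - q) + q * q) := by gcongr
    _ = _ := by rw [one_mul, add_assoc]

lemma tendsto_two_pow_mul {F : ℝ → ℝ} {c : ℝ} (h0 : F 0 = 0) (h : HasDerivAt F c 0) :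
    Tendsto (fun m : ℕ => (2 : ℝ) ^ m * F ((2 ^ m)⁻¹)) atTop (𝓝 c) := by
  have h1 := h.tendsto_slope_zero
  have h2 : Tendsto (fun m : ℕ => ((2 : ℝ) ^ m)⁻¹) atTop (𝓝[≠] 0) := by
    rw [tendsto_nhdsWithin_iff]
    refine ⟨?_, Eventually.of_forall fun m => by simp⟩
    simpa using tendsto_pow_atTop_nhds_zero_of_lt_one (r := (2 : ℝ)⁻¹) (by norm_num) (by norm_num)
  have := h1.comp h2
  simpa [Function.comp_def, h0] using this

lemma two_pow_mul_one_sub_expNeg {m : ℕ} {r : ℝ} (hr : 0 ≤ r) :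
    2 ^ m * (1 - expNeg (ENNReal.ofReal r)) = ENNReal.ofReal (2 ^ m * (1 - Real.exp (-r))) := by
  rw [expNeg_ofReal hr, ENNReal.ofReal_mul (by positivity), ENNReal.ofReal_sub _ (Real.exp_pos _).le,
    ENNReal.ofReal_pow (by norm_num)]
  simp

lemma inv_two_pow_eq_ofReal (m : ℕ) : ((2 : ℝ≥0∞) ^ m)⁻¹ = ENNReal.ofReal ((2 ^ m)⁻¹) := by
  rw [ENNReal.ofReal_inv_of_pos (by positivity), ENNReal.ofReal_pow (by norm_num)]
  simp

lemma tendsto_expQuot (a : ℝ≥0∞) : Tendsto (fun m => expQuot m a) atTop (𝓝 a) := by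
  unfold expQuot
  induction a with
  | top =>
    have : ∀ m : ℕ, ((2 : ℝ≥0∞) ^ m)⁻¹ * ∞ = ∞ := fun m => ENNReal.mul_top (by simp)
    simp only [this, expNeg_top, tsub_zero, mul_one]
    exact ENNReal.tendsto_pow_atTop_nhds_top_iff.2 (by norm_num)
  | coe a =>
    have hd : HasDerivAt (fun t : ℝ => 1 - Real.exp (-(t * a))) a 0 := by
      have := ((((hasDerivAt_id (0 : ℝ)).mul_const (a : ℝ)).neg).exp).const_sub 1
      simpa using this
    have h := ENNReal.tendsto_ofReal (tendsto_two_pow_mul (by simp) hd)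
    rw [ENNReal.ofReal_coe_nnreal] at h
    refine h.congr fun m => ?_
    rw [inv_two_pow_eq_ofReal, ← ENNReal.ofReal_coe_nnreal, ← ENNReal.ofReal_mul (by positivity),
      two_pow_mul_one_sub_expNeg (by positivity)]

/-- The derivative at `t = 0` of `1 - exp (-(1 - exp (-t)) c)`, the form the perturbed generating
functional takes on the deterministic side. -/
lemma tendsto_expQuot_one_sub {c : ℝ≥0∞} (hc : c ≠ ∞) :
    Tendsto (fun m : ℕ => 2 ^ m * (1 - expNeg ((1 - expNeg ((2 ^ m)⁻¹)) * c))) atTop (𝓝 c) := by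
  lift c to NNReal using hc
  have hd : HasDerivAt (fun t : ℝ => 1 - Real.exp (-((1 - Real.exp (-t)) * c))) c 0 := by
    have := ((((((hasDerivAt_id (0 : ℝ)).neg.exp).const_sub 1).mul_const (c : ℝ)).neg).exp).const_sub 1
    simpa using this
  have h := ENNReal.tendsto_ofReal (tendsto_two_pow_mul (by simp) hd)
  rw [ENNReal.ofReal_coe_nnreal] at h
  refine h.congr fun m => ?_
  have h1 : 0 ≤ 1 - Real.exp (-((2 : ℝ) ^ m)⁻¹) := by
    rw [sub_nonneg, Real.exp_le_one_iff, neg_nonpos]; positivity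
  rw [inv_two_pow_eq_ofReal, expNeg_ofReal (by positivity), ← ENNReal.ofReal_coe_nnreal,
    ← ENNReal.ofReal_one, ← ENNReal.ofReal_sub _ (Real.exp_pos _).le,
    ← ENNReal.ofReal_mul h1, ENNReal.ofReal_one,
    two_pow_mul_one_sub_expNeg (r := (1 - Real.exp (-((2 : ℝ) ^ m)⁻¹)) * c) (mul_nonneg h1 c.2)]

/-! ### Point processes and the Mecke formula -/

section Mecke

variable {Ω 𝕏 ι : Type*} [MeasurableSpace Ω] [MeasurableSpace 𝕏]

/-- The probability generating functional of the random points `X k` is that of a Poisson process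
with intensity measure `Λ`. -/
structure HasPoissonPGFL (X : ι → Ω → 𝕏) (Λ : Measure 𝕏) (μ : Measure Ω) : Prop where
  measurable_point : ∀ k, Measurable (X k)
  pgfl : ∀ u : 𝕏 → ℝ≥0∞, Measurable u →
    ∫⁻ ω, expNeg (∑' k, u (X k ω)) ∂μ = expNeg (∫⁻ x, 1 - expNeg (u x) ∂Λ)

variable [Countable ι] {X : ι → Ω → 𝕏} {Λ : Measure 𝕏} {μ : Measure Ω}

lemma one_sub_mul {a b : ℝ≥0∞} (ha : a ≤ 1) (hb : b ≤ 1) :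
    1 - a * b = (1 - a) + a * (1 - b) := by
  have ha' : a ≠ ∞ := (ha.trans_lt ENNReal.one_lt_top).ne
  have hb' : b ≠ ∞ := (hb.trans_lt ENNReal.one_lt_top).ne
  rw [ENNReal.mul_sub (fun _ _ => ha'), mul_one]
  refine ENNReal.sub_eq_of_eq_add (ENNReal.mul_ne_top ha' hb') ?_
  rw [add_assoc, tsub_add_cancel_of_le (mul_le_of_le_one_right' hb), tsub_add_cancel_of_le ha]

/-- This is the derivative at `t = 0` of the generating functional evaluated at `u + t * 1_C`: the
random side produces the number of points in `C`, the other side the integral over `C`. -/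
lemma HasPoissonPGFL.mecke_indicator (h : HasPoissonPGFL X Λ μ) {C : Set 𝕏}
    (hC : MeasurableSet C) (hΛC : Λ C ≠ ∞) {u : 𝕏 → ℝ≥0∞} (hu : Measurable u) :
    ∫⁻ ω, (∑' k, C.indicator 1 (X k ω)) * expNeg (∑' k, u (X k ω)) ∂μ =
      expNeg (∫⁻ x, 1 - expNeg (u x) ∂Λ) * ∫⁻ x in C, expNeg (u x) ∂Λ := by
  have hX := h.measurable_point
  set G : Ω → ℝ≥0∞ := fun ω => expNeg (∑' k, u (X k ω)) with hG
  set N : Ω → ℝ≥0∞ := fun ω => ∑' k, C.indicator 1 (X k ω) with hN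
  set c := ∫⁻ x in C, expNeg (u x) ∂Λ
  set L := expNeg (∫⁻ x, 1 - expNeg (u x) ∂Λ)
  have hGm : Measurable G := measurable_expNeg.comp (Measurable.tsum fun k => hu.comp (hX k))
  have hNm : Measurable N :=
    Measurable.tsum fun k => (measurable_one.indicator hC).comp (hX k)
  have hc : c ≠ ∞ := by
    refine ((lintegral_mono fun x => expNeg_le_one (u x)).trans_lt ?_).ne
    simpa using hΛC.lt_top
  have hLtop : L ≠ ∞ := expNeg_ne_top _
  have key : ∀ m : ℕ, ∫⁻ ω, expQuot m (N ω) * G ω ∂μ =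
      L * (2 ^ m * (1 - expNeg ((1 - expNeg ((2 ^ m)⁻¹)) * c))) := by
    intro m
    set t : ℝ≥0∞ := (2 ^ m)⁻¹
    have hut : Measurable fun x => u x + t * C.indicator 1 x :=
      hu.add ((measurable_one.indicator hC).const_mul t)
    have h1 : ∫⁻ ω, G ω * expNeg (t * N ω) ∂μ = L * expNeg ((1 - expNeg t) * c) := by
      have h2 := h.pgfl _ hut
      -- The perturbation by `t * 1_C` adds a separate term to the exponent, so it appears as a
      -- factor.
      have h3 : ∀ x, 1 - expNeg (u x + t * C.indicator 1 x) =
          (1 - expNeg (u x)) + C.indicator (fun x => expNeg (u x) * (1 - expNeg t)) x := by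
        intro x
        rw [expNeg_add, one_sub_mul (expNeg_le_one _) (expNeg_le_one _)]
        by_cases hx : x ∈ C <;> simp [hx]
      simp_rw [h3] at h2
      rw [lintegral_add_left (by fun_prop), lintegral_indicator hC,
        lintegral_mul_const _ (by fun_prop), expNeg_add] at h2
      rw [mul_comm (1 - expNeg t), ← h2]
      refine lintegral_congr fun ω => ?_
      rw [hG, hN, ENNReal.tsum_add, expNeg_add, ENNReal.tsum_mul_left]
    have hfin : ∫⁻ ω, G ω * expNeg (t * N ω) ∂μ ≠ ∞ := by
      rw [h1]; exact ENNReal.mul_ne_top hLtop (expNeg_ne_top _)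
    calc ∫⁻ ω, expQuot m (N ω) * G ω ∂μ
        = ∫⁻ ω, 2 ^ m * (G ω - G ω * expNeg (t * N ω)) ∂μ := by
          refine lintegral_congr fun ω => ?_
          rw [expQuot, mul_assoc, mul_comm _ (G ω), ENNReal.mul_sub (fun _ _ => expNeg_ne_top _),
            mul_one]
      _ = 2 ^ m * (L - L * expNeg ((1 - expNeg t) * c)) := by
          rw [lintegral_const_mul _ (by fun_prop), lintegral_sub (by fun_prop) hfin, h1,
            h.pgfl u hu]
          exact Eventually.of_forall fun ω => mul_le_of_le_one_right' (expNeg_le_one _)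
      _ = _ := by
          nth_rewrite 1 [← mul_one L]
          rw [← ENNReal.mul_sub (fun _ _ => hLtop)]
          ring
  have hlim1 : Tendsto (fun m => ∫⁻ ω, expQuot m (N ω) * G ω ∂μ) atTop
      (𝓝 (∫⁻ ω, N ω * G ω ∂μ)) := by
    refine lintegral_tendsto_of_tendsto_of_monotone (fun m => ?_) ?_ ?_
    · unfold expQuot; fun_prop
    · refine Eventually.of_forall fun ω => monotone_nat_of_le_succ fun m => ?_
      gcongr
      exact expQuot_le_succ m _
    · refine Eventually.of_forall fun ω => ?_
      exact ENNReal.Tendsto.mul_const (tendsto_expQuot _) (Or.inr (expNeg_ne_top _))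
  simp_rw [key] at hlim1
  exact tendsto_nhds_unique hlim1
    (ENNReal.Tendsto.const_mul (tendsto_expQuot_one_sub hc) (Or.inr hLtop))

/-- Mecke's formula for a functional that is the product of a function of the point and an
exponential functional of the whole configuration. -/
lemma HasPoissonPGFL.mecke_mul [SigmaFinite Λ] (h : HasPoissonPGFL X Λ μ) {f : 𝕏 → ℝ≥0∞}
    (hf : Measurable f) {u : 𝕏 → ℝ≥0∞} (hu : Measurable u) :
    ∫⁻ ω, ∑' k, f (X k ω) * expNeg (∑' k', u (X k' ω)) ∂μ =
      ∫⁻ x, f x * (expNeg (u x) * expNeg (∫⁻ y, 1 - expNeg (u y) ∂Λ)) ∂Λ := by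
  have hX := h.measurable_point
  set G : Ω → ℝ≥0∞ := fun ω => expNeg (∑' k, u (X k ω)) with hG
  have hGm : Measurable G := measurable_expNeg.comp (Measurable.tsum fun k => hu.comp (hX k))
  set L := expNeg (∫⁻ x, 1 - expNeg (u x) ∂Λ)
  -- Both sides are integrals of `f` against a measure; `ν₁` is the intensity of the points weighted
  -- by `G`. It suffices to compare the measures on sets.
  let ν₁ : Measure 𝕏 := Measure.sum fun k => (μ.withDensity G).map (X k)
  let ν₂ : Measure 𝕏 := Λ.withDensity fun x => expNeg (u x) * L
  have hint : ∀ f : 𝕏 → ℝ≥0∞, Measurable f →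
      ∫⁻ x, f x ∂ν₁ = ∫⁻ ω, ∑' k, f (X k ω) * G ω ∂μ := by
    intro f hf
    rw [lintegral_sum_measure, lintegral_tsum (f := fun k ω => f (X k ω) * G ω)
      fun k => ((hf.comp (hX k)).mul hGm).aemeasurable]
    refine tsum_congr fun k => ?_
    rw [lintegral_map hf (hX k)]
    refine (lintegral_withDensity_eq_lintegral_mul _ hGm (hf.comp (hX k))).trans ?_
    exact lintegral_congr fun ω => mul_comm _ _
  have hfinite : ∀ C, MeasurableSet C → Λ C ≠ ∞ → ν₁ C = ν₂ C := by
    intro C hC hΛC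
    rw [← lintegral_indicator_one hC, hint _ (measurable_one.indicator hC),
      withDensity_apply _ hC, lintegral_mul_const _ (by fun_prop), mul_comm _ L,
      ← h.mecke_indicator hC hΛC hu]
    exact lintegral_congr fun ω => ENNReal.tsum_mul_right
  have hν : ν₁ = ν₂ := by
    ext C hC
    -- Continuity from below along sets of finite `Λ`-measure extends the equality without
    -- finiteness of `ν₁`.
    have hU : C = ⋃ n, C ∩ spanningSets Λ n := by rw [← Set.inter_iUnion, iUnion_spanningSets,
      Set.inter_univ]
    have hmono : Monotone fun n => C ∩ spanningSets Λ n := fun m n hmn =>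
      Set.inter_subset_inter_right _ (monotone_spanningSets Λ hmn)
    rw [hU, hmono.measure_iUnion, hmono.measure_iUnion]
    refine iSup_congr fun n => hfinite _ (hC.inter (measurableSet_spanningSets Λ n)) ?_
    exact ((measure_mono Set.inter_subset_right).trans_lt (measure_spanningSets_lt_top Λ n)).ne
  rw [← hint f hf, hν, lintegral_withDensity_eq_lintegral_mul _ (by fun_prop) hf]
  exact lintegral_congr fun x => mul_comm _ _

/-- Mecke's formula for an exponential functional whose exponent depends on the point through a
countable label. -/
lemma HasPoissonPGFL.mecke_label [SigmaFinite Λ] (h : HasPoissonPGFL X Λ μ) {f : 𝕏 → ℝ≥0∞}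
    (hf : Measurable f) {c : 𝕏 → ℕ} (hc : Measurable c) {w : ℕ → 𝕏 → ℝ≥0∞}
    (hw : ∀ j, Measurable (w j)) :
    ∫⁻ ω, ∑' k, f (X k ω) * expNeg (∑' k', w (c (X k ω)) (X k' ω)) ∂μ =
      ∫⁻ x, f x * (expNeg (w (c x) x) * expNeg (∫⁻ y, 1 - expNeg (w (c x) y) ∂Λ)) ∂Λ := by
  have hX := h.measurable_point
  have hCm : ∀ j, MeasurableSet (c ⁻¹' {j}) := fun j => hc (measurableSet_singleton j)
  -- Where the label equals `j` the exponent is the fixed function `w j`, and `mecke_mul` applies.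
  have hsplit : ∀ (x : 𝕏) (Ψ : ℕ → ℝ≥0∞),
      f x * Ψ (c x) = ∑' j, (c ⁻¹' {j}).indicator f x * Ψ j := by
    intro x Ψ
    rw [tsum_eq_single (c x)]
    · simp
    · intro j hj
      simp [Set.indicator, hj.symm]
  have hm : ∀ j, Measurable fun ω => expNeg (∑' k', w j (X k' ω)) := fun j =>
    measurable_expNeg.comp (Measurable.tsum fun k => (hw j).comp (hX k))
  have hfm : ∀ j, Measurable ((c ⁻¹' {j}).indicator f) := fun j => hf.indicator (hCm j)
  calc ∫⁻ ω, ∑' k, f (X k ω) * expNeg (∑' k', w (c (X k ω)) (X k' ω)) ∂μ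
      = ∫⁻ ω, ∑' j, ∑' k, (c ⁻¹' {j}).indicator f (X k ω) * expNeg (∑' k', w j (X k' ω)) ∂μ := by
        refine lintegral_congr fun ω => ?_
        rw [ENNReal.tsum_comm]
        exact tsum_congr fun k => hsplit (X k ω) fun j => expNeg (∑' k', w j (X k' ω))
    _ = ∑' j, ∫⁻ ω, ∑' k, (c ⁻¹' {j}).indicator f (X k ω) * expNeg (∑' k', w j (X k' ω)) ∂μ := by
        refine lintegral_tsum fun j => (Measurable.tsum fun k => ?_).aemeasurable
        exact ((hfm j).comp (hX k)).mul (hm j)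
    _ = ∑' j, ∫⁻ x, (c ⁻¹' {j}).indicator f x *
          (expNeg (w j x) * expNeg (∫⁻ y, 1 - expNeg (w j y) ∂Λ)) ∂Λ :=
        tsum_congr fun j => h.mecke_mul (hfm j) (hw j)
    _ = ∫⁻ x, ∑' j, (c ⁻¹' {j}).indicator f x *
          (expNeg (w j x) * expNeg (∫⁻ y, 1 - expNeg (w j y) ∂Λ)) ∂Λ := by
        refine (lintegral_tsum fun j => Measurable.aemeasurable ?_).symm
        exact (hfm j).mul ((measurable_expNeg.comp (hw j)).mul_const _)
    _ = _ := lintegral_congr fun x =>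
        (hsplit x fun j => expNeg (w j x) * expNeg (∫⁻ y, 1 - expNeg (w j y) ∂Λ)).symm

/-- Mecke's formula for an exponential functional whose exponent is an increasing limit of exponents
that depend on the point through a countable label. -/
lemma HasPoissonPGFL.mecke_of_tendsto [SigmaFinite Λ] (h : HasPoissonPGFL X Λ μ) {f : 𝕏 → ℝ≥0∞}
    (hf : Measurable f) (hfint : ∫⁻ x, f x ∂Λ ≠ ∞) {c : ℕ → 𝕏 → ℕ} (hc : ∀ n, Measurable (c n))
    {w : ℕ → ℕ → 𝕏 → ℝ≥0∞} (hw : ∀ n j, Measurable (w n j)) {u : 𝕏 → 𝕏 → ℝ≥0∞}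
    (hmono : ∀ x y, Monotone fun n => w n (c n x) y)
    (hlim : ∀ x y, Tendsto (fun n => w n (c n x) y) atTop (𝓝 (u x y))) :
    ∫⁻ ω, ∑' k, f (X k ω) * expNeg (∑' k', u (X k ω) (X k' ω)) ∂μ =
      ∫⁻ x, f x * (expNeg (u x x) * expNeg (∫⁻ y, 1 - expNeg (u x y) ∂Λ)) ∂Λ := by
  have hX := h.measurable_point
  have hle1 : ∀ a b : ℝ≥0∞, a * expNeg b ≤ a := fun a b => mul_le_of_le_one_right' (expNeg_le_one _)
  -- The zero exponent gives Campbell's formula, which provides the integrable majorant for the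
  -- limit in `n`.
  have hftot : ∫⁻ ω, ∑' k, f (X k ω) ∂μ = ∫⁻ x, f x ∂Λ := by
    simpa using h.mecke_mul hf (u := 0) measurable_zero
  -- Joint measurability is available because the label takes countably many values.
  have hwm : ∀ n, Measurable fun p : 𝕏 × 𝕏 => w n (c n p.1) p.2 := fun n =>
    (measurable_from_prod_countable_right (f := fun p : ℕ × 𝕏 => w n p.1 p.2) (hw n)).comp
      (((hc n).comp measurable_fst).prodMk measurable_snd)
  have hsum : ∀ ω k, Tendsto (fun n => ∑' k', w n (c n (X k ω)) (X k' ω)) atTop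
      (𝓝 (∑' k', u (X k ω) (X k' ω))) := by
    intro ω k
    let : MeasurableSpace ι := ⊤
    simp_rw [← lintegral_count]
    exact lintegral_tendsto_of_tendsto_of_monotone (fun n => (measurable_of_countable _).aemeasurable)
      (Eventually.of_forall fun k' => hmono _ _) (Eventually.of_forall fun k' => hlim _ _)
  have hmeasS : ∀ n k, Measurable fun ω =>
      f (X k ω) * expNeg (∑' k', w n (c n (X k ω)) (X k' ω)) := fun n k =>
    (hf.comp (hX k)).mul (measurable_expNeg.comp (Measurable.tsum fun k' =>
      (hwm n).comp ((hX k).prodMk (hX k'))))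
  have hffin : ∀ᵐ ω ∂μ, ∑' k, f (X k ω) < ∞ :=
    ae_lt_top (Measurable.tsum fun k => hf.comp (hX k)) (hftot ▸ hfint)
  have hL : Tendsto (fun n => ∫⁻ ω, ∑' k, f (X k ω) *
      expNeg (∑' k', w n (c n (X k ω)) (X k' ω)) ∂μ) atTop
      (𝓝 (∫⁻ ω, ∑' k, f (X k ω) * expNeg (∑' k', u (X k ω) (X k' ω)) ∂μ)) := by
    refine tendsto_lintegral_of_dominated_convergence (fun ω => ∑' k, f (X k ω))
      (fun n => Measurable.tsum (hmeasS n))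
      (fun n => Eventually.of_forall fun ω => ENNReal.tsum_le_tsum fun k => hle1 _ _)
      (hftot ▸ hfint) ?_
    filter_upwards [hffin] with ω hω
    let : MeasurableSpace ι := ⊤
    simp_rw [← lintegral_count]
    refine tendsto_lintegral_of_dominated_convergence (fun k => f (X k ω))
      (fun n => measurable_of_countable _)
      (fun n => Eventually.of_forall fun k => hle1 _ _)
      (by rw [lintegral_count]; exact hω.ne) (Eventually.of_forall fun k => ?_)
    simp_rw [lintegral_count]
    exact ENNReal.Tendsto.const_mul ((continuous_expNeg.tendsto _).comp (hsum ω k))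
      (Or.inr (ne_top_of_le_ne_top hω.ne (ENNReal.le_tsum k)))
  have hR : Tendsto (fun n => ∫⁻ x, f x * (expNeg (w n (c n x) x) *
      expNeg (∫⁻ y, 1 - expNeg (w n (c n x) y) ∂Λ)) ∂Λ) atTop
      (𝓝 (∫⁻ x, f x * (expNeg (u x x) * expNeg (∫⁻ y, 1 - expNeg (u x y) ∂Λ)) ∂Λ)) := by
    refine tendsto_lintegral_of_dominated_convergence f (fun n => ?_)
      (fun n => Eventually.of_forall fun x => mul_le_of_le_one_right'
        (mul_le_one' (expNeg_le_one _) (expNeg_le_one _))) hfint ?_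
    · refine hf.mul ((measurable_expNeg.comp ((hwm n).comp (measurable_id.prodMk measurable_id))).mul
        ?_)
      exact (measurable_of_countable fun j => expNeg (∫⁻ y, 1 - expNeg (w n j y) ∂Λ)).comp (hc n)
    · filter_upwards [ae_lt_top hf hfint] with x hx
      refine ENNReal.Tendsto.const_mul ?_ (Or.inr hx.ne)
      refine ENNReal.Tendsto.mul ((continuous_expNeg.tendsto _).comp (hlim x x))
        (Or.inr (expNeg_ne_top _)) ((continuous_expNeg.tendsto _).comp ?_) (Or.inr (expNeg_ne_top _))
      refine lintegral_tendsto_of_tendsto_of_monotone (fun n => ?_)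
        (Eventually.of_forall fun y m n hmn => ?_) (Eventually.of_forall fun y => ?_)
      · exact ((measurable_expNeg.comp (hw n _)).const_sub 1).aemeasurable
      · exact tsub_le_tsub_left (expNeg_antitone (hmono x y hmn)) 1
      · exact ENNReal.Tendsto.sub tendsto_const_nhds ((continuous_expNeg.tendsto _).comp (hlim x y))
          (Or.inl ENNReal.one_ne_top)
  simp_rw [fun n => h.mecke_label hf (hc n) (hw n)] at hL
  exact tendsto_nhds_unique hL hR

end Mecke

/-! ### Poisson processes -/

section Poisson

variable {Ω : Type*}

lemma tsum_indicator_eq_count (X : ℕ → Ω → Plane) (B : Set Plane) (ω : Ω) :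
    ∑' n, B.indicator (1 : Plane → ℝ≥0∞) (X n ω) = (count X B ω : ℝ≥0∞) := by
  rw [count, ← ENNReal.tsum_set_one, tsum_subtype {n | X n ω ∈ B} fun _ => (1 : ℝ≥0∞)]
  exact tsum_congr fun n => by by_cases h : X n ω ∈ B <;> simp [h]

variable [MeasurableSpace Ω] {μ : Measure Ω}

lemma measurable_count {X : ℕ → Ω → Plane} (hX : ∀ n, Measurable (X n)) {B : Set Plane}
    (hB : MeasurableSet B) : Measurable (count X B) := by
  have h1 : Measurable fun ω => (count X B ω : ℝ≥0∞) := by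
    simp_rw [← tsum_indicator_eq_count]
    exact Measurable.tsum fun n => (measurable_one.indicator hB).comp (hX n)
  refine measurable_to_countable' fun k => ?_
  have : count X B ⁻¹' {k} = (fun ω => (count X B ω : ℝ≥0∞)) ⁻¹' {(k : ℝ≥0∞)} := by
    ext ω; simp
  rw [this]
  exact h1 (measurableSet_singleton _)

/-- The Poisson generating function at `q = exp (-c)`; the case `c = ∞` is `q = 0`, with `0 ^ 0 =
1`. -/
lemma lintegral_expNeg_mul_poissonMeasure (r : NNReal) (c : ℝ≥0∞) :
    ∫⁻ n : ℕ, expNeg (c * n) ∂(poissonMeasure r) = expNeg ((1 - expNeg c) * r) := by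
  set q : ℝ := (expNeg c).toReal with hq
  have hq0 : 0 ≤ q := ENNReal.toReal_nonneg
  have hcq : expNeg c = ENNReal.ofReal q := (ENNReal.ofReal_toReal (expNeg_ne_top c)).symm
  have hq1 : q ≤ 1 := by simpa using ENNReal.toReal_mono ENNReal.one_ne_top (expNeg_le_one c)
  have hpow : ∀ n : ℕ, expNeg (c * n) = ENNReal.ofReal (q ^ n) := by
    intro n
    have := expNeg_sum (Finset.range n) fun _ => c
    rw [Finset.sum_const, Finset.prod_const, Finset.card_range, nsmul_eq_mul, mul_comm] at this
    rw [this, hcq, ENNReal.ofReal_pow hq0]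
  have hs : HasSum (fun n : ℕ => q ^ n * (Real.exp (-r) * r ^ n / n.factorial))
      (Real.exp (-((1 - q) * r))) := by
    have h := (NormedSpace.expSeries_div_hasSum_exp (q * r : ℝ)).mul_left (Real.exp (-r))
    rw [← Real.exp_eq_exp_ℝ, ← Real.exp_add] at h
    rw [show -(r : ℝ) + q * r = -((1 - q) * r) by ring] at h
    have e : ∀ n : ℕ, q ^ n * (Real.exp (-r) * r ^ n / n.factorial) =
        Real.exp (-r) * ((q * r) ^ n / n.factorial) := fun n => by rw [mul_pow]; ring
    simp_rw [e]
    exact h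
  have h1 : (1 - expNeg c) * (r : ℝ≥0∞) = ENNReal.ofReal ((1 - q) * r) := by
    rw [hcq, ENNReal.ofReal_mul (by linarith), ENNReal.ofReal_sub _ hq0, ENNReal.ofReal_one,
      ENNReal.ofReal_coe_nnreal]
  rw [lintegral_countable', h1, expNeg_ofReal (r := (1 - q) * r) (mul_nonneg (by linarith) r.2), ← hs.tsum_eq,
    ENNReal.ofReal_tsum_of_nonneg (fun n => by positivity) hs.summable]
  refine tsum_congr fun n => ?_
  rw [hpow, poissonMeasure_singleton, ← ENNReal.ofReal_mul (by positivity)]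

variable [IsProbabilityMeasure μ] {X : ℕ → Ω → Plane} {lam : ℝ}

lemma IsHomogeneousPoissonProcess.lintegral_expNeg_count
    (h : IsHomogeneousPoissonProcess X lam μ) {B : Set Plane} (hB : MeasurableSet B)
    (hB' : volume B ≠ ∞) (c : ℝ≥0∞) :
    ∫⁻ ω, expNeg (c * (count X B ω : ℝ≥0∞)) ∂μ =
      expNeg ((1 - expNeg c) * (ENNReal.ofReal lam * volume B)) := by
  set r := (ENNReal.ofReal lam * volume B).toNNReal with hr
  have hrr : (r : ℝ≥0∞) = ENNReal.ofReal lam * volume B :=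
    ENNReal.coe_toNNReal (ENNReal.mul_ne_top ENNReal.ofReal_ne_top hB')
  have hcm := measurable_count h.measurable_point hB
  have hcast : Measurable (fun n : ℕ => (n : ℕ∞)) := measurable_of_countable _
  -- `count_law` speaks of finite counts only. The Poisson masses already add up to one, so no mass
  -- is left at `∞` and this inequality of probability measures is an equality.
  have hle : (poissonMeasure r).map (fun n : ℕ => (n : ℕ∞)) ≤ μ.map (count X B) := by
    refine Measure.le_iff.2 fun s hs => ?_
    rw [Measure.map_apply hcast hs, ← lintegral_indicator_one hs, ← lintegral_indicator_one (hcast hs),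
      lintegral_countable', lintegral_countable']
    calc ∑' n : ℕ, ((fun n : ℕ => (n : ℕ∞)) ⁻¹' s).indicator 1 n * poissonMeasure r {n}
        = ∑' n : ℕ, s.indicator 1 (n : ℕ∞) * μ.map (count X B) {(n : ℕ∞)} := by
          refine tsum_congr fun n => ?_
          rw [Measure.map_apply hcm (measurableSet_singleton _), hr, ← h.count_law B hB hB' n]
          rfl
      _ ≤ ∑' k : ℕ∞, s.indicator 1 k * μ.map (count X B) {k} :=
          ENNReal.tsum_comp_le_tsum_of_injective (f := fun n : ℕ => (n : ℕ∞))
            (fun a b hab => by simpa using hab) _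
  have heq : (poissonMeasure r).map (fun n : ℕ => (n : ℕ∞)) = μ.map (count X B) := by
    refine Measure.eq_of_le_of_measure_univ_eq hle ?_
    rw [Measure.map_apply hcast .univ, Measure.map_apply hcm .univ]
    simp
  have hφ : Measurable fun k : ℕ∞ => expNeg (c * (k : ℝ≥0∞)) := measurable_of_countable _
  rw [← lintegral_map hφ hcm, ← heq, lintegral_map hφ hcast, ← hrr,
    ← lintegral_expNeg_mul_poissonMeasure]
  simp

/-- Used for `h = id` on the random side and for `h a = 1 - exp (-a)` on the deterministic side;
both vanish at `0`, as they must outside `K`. -/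
lemma SimpleFunc.comp_indicator_eq_sum (φ : SimpleFunc Plane ℝ≥0∞) (K : Set Plane)
    {h : ℝ≥0∞ → ℝ≥0∞} (h0 : h 0 = 0) (x : Plane) :
    h (K.indicator φ x) =
      ∑ c : φ.range, h c * (K ∩ φ ⁻¹' {(c : ℝ≥0∞)}).indicator 1 x := by
  by_cases hx : x ∈ K
  · rw [Finset.sum_eq_single (⟨φ x, φ.mem_range_self x⟩ : φ.range)]
    · simp [hx]
    · rintro ⟨c, hc⟩ - hne
      have : φ x ≠ c := fun h => hne (Subtype.ext h.symm)
      simp [this]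
    · simp
  · simp [hx, h0]

/-- The configuration enters only through the counts of disjoint level sets, which are independent
Poisson variables. Cutting with `K` keeps every level set, that of the value `0` included, of finite
area. -/
lemma IsHomogeneousPoissonProcess.pgfl_simpleFunc
    (h : IsHomogeneousPoissonProcess X lam μ) (φ : SimpleFunc Plane ℝ≥0∞) {K : Set Plane}
    (hK : MeasurableSet K) (hK' : volume K ≠ ∞) :
    ∫⁻ ω, expNeg (∑' n, K.indicator φ (X n ω)) ∂μ =
      expNeg (ENNReal.ofReal lam * ∫⁻ x, 1 - expNeg (K.indicator φ x)) := by
  let B : φ.range → Set Plane := fun c => K ∩ φ ⁻¹' {(c : ℝ≥0∞)}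
  have hB : ∀ c, MeasurableSet (B c) := fun c => hK.inter (φ.measurableSet_fiber _)
  have hB' : ∀ c, volume (B c) ≠ ∞ := fun c =>
    ((measure_mono Set.inter_subset_left).trans_lt hK'.lt_top).ne
  have hdisj : Pairwise fun c d => Disjoint (B c) (B d) := by
    intro c d hcd
    refine Set.disjoint_left.2 fun x hx hx' => hcd (Subtype.ext ?_)
    exact hx.2.symm.trans hx'.2
  let e := Fintype.equivFin φ.range
  have hind : iIndepFun (fun c => count X (B c)) μ := by
    have := (h.count_indep _ (fun j => B (e.symm j)) (fun j => hB _)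
      fun i j hij => hdisj (e.symm.injective.ne hij)).precomp e.injective
    simpa using this
  have hcomp : ∀ c : φ.range, Measurable fun k : ℕ∞ => expNeg ((c : ℝ≥0∞) * (k : ℝ≥0∞)) :=
    fun c => measurable_of_countable _
  have hsum : ∀ ω, expNeg (∑' n, K.indicator φ (X n ω)) =
      ∏ c : φ.range, expNeg ((c : ℝ≥0∞) * (count X (B c) ω : ℝ≥0∞)) := by
    intro ω
    rw [← expNeg_sum]
    congr 1
    have hpt : ∀ x, K.indicator φ x = ∑ c : φ.range, (c : ℝ≥0∞) * (B c).indicator 1 x :=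
      SimpleFunc.comp_indicator_eq_sum φ K (h := id) rfl
    simp_rw [hpt]
    rw [Summable.tsum_finsetSum fun _ _ => ENNReal.summable]
    exact Finset.sum_congr rfl fun c _ => by rw [ENNReal.tsum_mul_left, tsum_indicator_eq_count]
  simp_rw [hsum]
  rw [lintegral_prod_eq_prod_lintegral_of_indepFun _
    (fun (c : φ.range) ω => expNeg ((c : ℝ≥0∞) * (count X (B c) ω : ℝ≥0∞)))
    (hind.comp _ hcomp) fun c => (hcomp c).comp (measurable_count h.measurable_point (hB c))]
  simp_rw [fun c => h.lintegral_expNeg_count (hB c) (hB' c)]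
  rw [← expNeg_sum]
  congr 1
  have hpt : ∀ x, 1 - expNeg (K.indicator φ x) =
      ∑ c : φ.range, (1 - expNeg (c : ℝ≥0∞)) * (B c).indicator 1 x :=
    SimpleFunc.comp_indicator_eq_sum φ K (h := fun a => 1 - expNeg a) (by simp)
  simp_rw [hpt]
  rw [lintegral_finsetSum _ fun c _ => (measurable_one.indicator (hB c)).const_mul _, Finset.mul_sum]
  refine Finset.sum_congr rfl fun c _ => ?_
  rw [lintegral_const_mul _ (measurable_one.indicator (hB c)), lintegral_indicator_one (hB c)]
  ring

/-- The probability generating functional of a homogeneous Poisson process. -/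
lemma IsHomogeneousPoissonProcess.pgfl (h : IsHomogeneousPoissonProcess X lam μ)
    {u : Plane → ℝ≥0∞} (hu : Measurable u) :
    ∫⁻ ω, expNeg (∑' n, u (X n ω)) ∂μ =
      expNeg (ENNReal.ofReal lam * ∫⁻ x, 1 - expNeg (u x)) := by
  have hX := h.measurable_point
  let K : ℕ → Set Plane := spanningSets volume
  have hK : ∀ n, MeasurableSet (K n) := measurableSet_spanningSets _
  let φ : ℕ → SimpleFunc Plane ℝ≥0∞ := SimpleFunc.eapprox u
  -- Increasing approximations of `u` by simple functions cut off to sets of finite area.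
  let v : ℕ → Plane → ℝ≥0∞ := fun n => (K n).indicator (φ n)
  have hvm : ∀ n, Measurable (v n) := fun n => (φ n).measurable.indicator (hK n)
  have hmono : ∀ x, Monotone fun n => v n x := by
    intro x m n hmn
    refine (Set.indicator_le_indicator_of_subset (monotone_spanningSets _ hmn)
      (fun _ => bot_le) x).trans (Set.indicator_le_indicator ?_)
    exact SimpleFunc.monotone_eapprox u hmn x
  have hlim : ∀ x, Tendsto (fun n => v n x) atTop (𝓝 (u x)) := by
    intro x
    refine (SimpleFunc.tendsto_eapprox hu x).congr' ?_
    filter_upwards [eventually_ge_atTop (spanningSetsIndex volume x)] with n hn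
    have : x ∈ K n := monotone_spanningSets _ hn (mem_spanningSetsIndex volume x)
    simp [v, φ, this]
  have hL : Tendsto (fun m => ∫⁻ ω, expNeg (∑' n, v m (X n ω)) ∂μ) atTop
      (𝓝 (∫⁻ ω, expNeg (∑' n, u (X n ω)) ∂μ)) := by
    refine tendsto_lintegral_of_dominated_convergence 1
      (fun m => measurable_expNeg.comp (Measurable.tsum fun n => (hvm m).comp (hX n)))
      (fun m => Eventually.of_forall fun ω => expNeg_le_one _) (by simp)
      (Eventually.of_forall fun ω => (continuous_expNeg.tendsto _).comp ?_)
    simp_rw [← lintegral_count]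
    exact lintegral_tendsto_of_tendsto_of_monotone (fun n => (measurable_of_countable _).aemeasurable)
      (Eventually.of_forall fun n => hmono _) (Eventually.of_forall fun n => hlim _)
  have hR : Tendsto (fun m => expNeg (ENNReal.ofReal lam * ∫⁻ x, 1 - expNeg (v m x))) atTop
      (𝓝 (expNeg (ENNReal.ofReal lam * ∫⁻ x, 1 - expNeg (u x)))) := by
    refine (continuous_expNeg.tendsto _).comp
      (ENNReal.Tendsto.const_mul ?_ (Or.inr ENNReal.ofReal_ne_top))
    refine lintegral_tendsto_of_tendsto_of_monotone
      (fun m => ((measurable_expNeg.comp (hvm m)).const_sub 1).aemeasurable)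
      (Eventually.of_forall fun x m n hmn => tsub_le_tsub_left (expNeg_antitone (hmono x hmn)) 1)
      (Eventually.of_forall fun x => ENNReal.Tendsto.sub tendsto_const_nhds
        ((continuous_expNeg.tendsto _).comp (hlim x)) (Or.inl ENNReal.one_ne_top))
  refine tendsto_nhds_unique hL (hR.congr fun m => ?_)
  exact (h.pgfl_simpleFunc (φ m) (hK m) (measure_spanningSets_lt_top _ m).ne).symm

end Poisson

/-! ### Superposition of the processes of all types -/

section Superposition

variable {M : ℕ} {Ω : Type*} [MeasurableSpace Ω] {μ : Measure Ω}

/-- The intensity measure of the process of all potential transmitters, marked by their types. -/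
def typedIntensity (lam : Fin M → ℝ) : Measure (Fin M × Plane) :=
  (Measure.count.withDensity fun i => ENNReal.ofReal (lam i)).prod volume

instance (lam : Fin M → ℝ) : SigmaFinite (typedIntensity lam) := by
  unfold typedIntensity; infer_instance

lemma lintegral_typedIntensity (lam : Fin M → ℝ) {f : Fin M × Plane → ℝ≥0∞} (hf : Measurable f) :
    ∫⁻ p, f p ∂(typedIntensity lam) = ∑ i, ENNReal.ofReal (lam i) * ∫⁻ x, f (i, x) := by
  rw [typedIntensity, lintegral_prod _ hf.aemeasurable,
    lintegral_withDensity_eq_lintegral_mul _ (measurable_of_countable _) (measurable_of_countable _),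
    lintegral_count, tsum_fintype]
  rfl

namespace Network

variable {N : Network M Ω} {lam pt pf : Fin M → ℝ} {δ : ℝ}

/-- The potential transmitters, marked by their types. -/
def typedTx (N : Network M Ω) (k : Link M) (ω : Ω) : Fin M × Plane := (k.1, N.txOf k ω)

lemma IsModel.measurable_tx (hN : N.IsModel lam pt pf δ μ) (k : Link M) : Measurable (N.txOf k) :=
  (hN.poisson k.1).measurable_point k.2

/-- The generating functionals of independent processes multiply, so their exponents add up to one
integral over the typed plane. -/
lemma IsModel.hasPoissonPGFL [IsProbabilityMeasure μ] (hN : N.IsModel lam pt pf δ μ) :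
    HasPoissonPGFL N.typedTx (typedIntensity lam) μ where
  measurable_point k := measurable_const.prodMk (hN.measurable_tx k)
  pgfl u hu := by
    have hui : ∀ i, Measurable fun x => u (i, x) := fun i => hu.comp measurable_prodMk_left
    have hind : iIndepFun (fun i ω n => N.tx i n ω) μ :=
      hN.indep.precomp (g := Source.points) fun i j hij => by simpa using hij
    have hF : ∀ i, Measurable fun x : ℕ → Plane => expNeg (∑' n, u (i, x n)) := fun i =>
      measurable_expNeg.comp (Measurable.tsum fun n => (hui i).comp (measurable_pi_apply n))
    have hsum : ∀ ω, expNeg (∑' k, u (N.typedTx k ω)) =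
        ∏ i, expNeg (∑' n, u (i, N.tx i n ω)) := by
      intro ω
      rw [ENNReal.tsum_prod', tsum_fintype, expNeg_sum]
      rfl
    simp_rw [hsum]
    rw [lintegral_prod_eq_prod_lintegral_of_indepFun _
      (fun i ω => expNeg (∑' n, u (i, N.tx i n ω))) (hind.comp _ hF) fun i =>
        (hF i).comp (measurable_pi_lambda _ fun n => (hN.poisson i).measurable_point n)]
    simp_rw [fun i => (hN.poisson i).pgfl (hui i)]
    rw [← expNeg_sum, lintegral_typedIntensity lam (f := fun p => 1 - expNeg (u p)) (by fun_prop)]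

end Network

end Superposition

/-! ### Mecke's formula for translation invariant functionals -/

/-- A countably valued approximation of the identity: the label is the first point of a dense
sequence closer than `ε`. -/
lemma exists_measurable_label {ε : ℝ} (hε : 0 < ε) :
    ∃ c : Plane → ℕ, Measurable c ∧ ∀ x, dist x (TopologicalSpace.denseSeq Plane (c x)) < ε := by
  classical
  have hex : ∀ x : Plane, ∃ j, dist x (TopologicalSpace.denseSeq Plane j) < ε := fun x =>
    (TopologicalSpace.denseRange_denseSeq Plane).exists_dist_lt x hε
  refine ⟨fun x => Nat.find (hex x), measurable_find hex fun j => ?_, fun x => Nat.find_spec (hex x)⟩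
  exact measurableSet_lt (by fun_prop) measurable_const

lemma tsum_eq_add_tsum_ne {ι : Type*} [DecidableEq ι] (a : ι → ℝ≥0∞) (l : ι) :
    ∑' k, a k = a l + ∑' k, if k ≠ l then a k else 0 := by
  rw [ENNReal.tsum_eq_add_tsum_ite l]
  congr 1
  exact tsum_congr fun k => by by_cases h : k = l <;> simp [h]

section Mecke

variable {M : ℕ} {Ω : Type*} [MeasurableSpace Ω] {μ : Measure Ω} [IsProbabilityMeasure μ]
  {N : Network M Ω} {lam pt pf : Fin M → ℝ} {δ : ℝ}

namespace Network

/-- The inner sum includes the point itself, which lies at distance `‖z‖` from its receiver; this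
gives the factor `exp (-v ‖z‖)`. By translation invariance the other factor does not depend on the
point and leaves the integral. -/
lemma IsModel.mecke_radial (hN : N.IsModel lam pt pf δ μ) {f : Fin M × Plane → ℝ≥0∞}
    (hf : Measurable f) (hfint : ∫⁻ p, f p ∂(typedIntensity lam) ≠ ∞)
    {v : Fin M → ℝ≥0∞ → ℝ≥0∞} (hv : ∀ i, Antitone (v i)) (hvc : ∀ i, Continuous (v i)) (z : Plane) :
    ∫⁻ ω, ∑' k, f (N.typedTx k ω) *
        expNeg (∑' k' : Link M, v k'.1 ‖N.txOf k' ω - (N.txOf k ω + z)‖ₑ) ∂μ =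
      (∫⁻ p, f p * expNeg (v p.1 ‖z‖ₑ) ∂(typedIntensity lam)) *
        expNeg (∑ j, ENNReal.ofReal (lam j) * ∫⁻ y : Plane, 1 - expNeg (v j ‖y‖ₑ)) := by
  have hvm : ∀ i, Measurable (v i) := fun i => (hvc i).measurable
  choose c hcm hc using fun n : ℕ => exists_measurable_label (ε := (1 / 2) ^ n) (by positivity)
  let d := TopologicalSpace.denseSeq Plane
  -- From `n` to `n + 1` the approximate centre moves by at most `(3 / 2) * (1 / 2) ^ n`, exactly
  -- the decrease of `3 * (1 / 2) ^ n`. The approximate distances therefore decrease, and the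
  -- exponents increase since `v` is antitone.
  let w : ℕ → ℕ → Fin M × Plane → ℝ≥0∞ := fun n j p =>
    v p.1 (ENNReal.ofReal (‖p.2 - z - d j‖ + 3 * (1 / 2) ^ n))
  have hw : ∀ n j, Measurable (w n j) := fun n j =>
    measurable_from_prod_countable_right fun i => (hvm i).comp (by fun_prop)
  have hmono : ∀ x y, Monotone fun n => w n (c n x) y := by
    refine fun x y => monotone_nat_of_le_succ fun n => hv _ (ENNReal.ofReal_le_ofReal ?_)
    have h1 : ‖y.2 - z - d (c (n + 1) x)‖ ≤ ‖y.2 - z - d (c n x)‖ +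
        (dist x (d (c n x)) + dist x (d (c (n + 1) x))) := by
      rw [← dist_eq_norm, ← dist_eq_norm]
      linarith [dist_triangle (y.2 - z) (d (c n x)) (d (c (n + 1) x)),
        dist_triangle_left (d (c n x)) (d (c (n + 1) x)) x]
    have h2 := hc n x
    have h3 := hc (n + 1) x
    rw [pow_succ] at h3 ⊢
    linarith
  have hpow : Tendsto (fun n : ℕ => ((1 : ℝ) / 2) ^ n) atTop (𝓝 0) :=
    tendsto_pow_atTop_nhds_zero_of_lt_one (by norm_num) (by norm_num)
  have hlim : ∀ x (y : Fin M × Plane), Tendsto (fun n => w n (c n x) y) atTop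
      (𝓝 (v y.1 ‖y.2 - (x + z)‖ₑ)) := by
    intro x y
    refine ((hvc y.1).tendsto _).comp ?_
    rw [← ofReal_norm]
    refine ENNReal.tendsto_ofReal ?_
    have hd : Tendsto (fun n => d (c n x)) atTop (𝓝 x) := by
      rw [tendsto_iff_dist_tendsto_zero]
      refine squeeze_zero (fun _ => dist_nonneg) (fun n => ?_) hpow
      rw [dist_comm]
      exact (hc n x).le
    have := ((tendsto_const_nhds (x := y.2 - z)).sub hd).norm.add (hpow.const_mul 3)
    rw [show y.2 - z - x = y.2 - (x + z) by abel, mul_zero, add_zero] at this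
    exact this
  have key := hN.hasPoissonPGFL.mecke_of_tendsto hf hfint
    (c := fun n p => c n p.2) (fun n => (hcm n).comp measurable_snd) hw
    (u := fun p q => v q.1 ‖q.2 - (p.2 + z)‖ₑ) (fun x y => hmono x.2 y) (fun x y => hlim x.2 y)
  refine key.trans ?_
  rw [← lintegral_mul_const]
  · refine lintegral_congr fun p => ?_
    rw [mul_assoc, sub_add_cancel_left, enorm_neg]
    congr 3
    rw [lintegral_typedIntensity]
    · refine Finset.sum_congr rfl fun j _ => ?_
      rw [lintegral_sub_right_eq_self fun y : Plane => 1 - expNeg (v j ‖y‖ₑ)]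
    · exact measurable_from_prod_countable_right fun i => by
        have := hvm i
        change Measurable fun y : Plane => 1 - expNeg (v i ‖y - (p.2 + z)‖ₑ)
        fun_prop
  · exact hf.mul (measurable_expNeg.comp (measurable_from_prod_countable_right fun i =>
      (measurable_const : Measurable fun _ : Plane => v i ‖z‖ₑ)))

/-- Mecke's formula for the configuration without the point itself, seen from the point of the
plane that is displaced by `z` from it. -/
lemma IsModel.mecke_removed (hN : N.IsModel lam pt pf δ μ) {A : Set Plane} (hA : MeasurableSet A)
    (hA' : volume A ≠ ∞) {p : Fin M → ℝ≥0∞} (hp : ∀ i, p i ≠ ∞)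
    {v : Fin M → ℝ≥0∞ → ℝ≥0∞} (hv : ∀ i, Antitone (v i)) (hvc : ∀ i, Continuous (v i)) {z : Plane}
    (hz : ∀ i, v i ‖z‖ₑ ≠ ∞) :
    ∫⁻ ω, ∑' l : Link M, p l.1 * A.indicator 1 (N.txOf l ω + z) *
        expNeg (∑' k : Link M, if k ≠ l then v k.1 ‖N.txOf k ω - (N.txOf l ω + z)‖ₑ else 0) ∂μ =
      (∑ i, ENNReal.ofReal (lam i) * p i) * volume A *
        expNeg (∑ j, ENNReal.ofReal (lam j) * ∫⁻ y : Plane, 1 - expNeg (v j ‖y‖ₑ)) := by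
  -- The point itself contributes the deterministic factor `exp (-v ‖z‖)`, nonzero by `hz`.
  -- Absorbing its inverse into `f` removes the point from the configuration.
  let q : Fin M → ℝ≥0∞ := fun i => (expNeg (v i ‖z‖ₑ))⁻¹
  have hq : ∀ i, q i * expNeg (v i ‖z‖ₑ) = 1 := fun i =>
    ENNReal.inv_mul_cancel (expNeg_ne_zero (hz i)) (expNeg_ne_top _)
  have hqtop : ∀ i, q i ≠ ∞ := fun i => ENNReal.inv_ne_top.2 (expNeg_ne_zero (hz i))
  let f : Fin M × Plane → ℝ≥0∞ := fun x => p x.1 * A.indicator 1 (x.2 + z) * q x.1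
  have hAm : Measurable fun x : Plane => A.indicator (1 : Plane → ℝ≥0∞) (x + z) :=
    (measurable_one.indicator hA).comp (measurable_add_const z)
  have hAint : ∫⁻ x : Plane, A.indicator (1 : Plane → ℝ≥0∞) (x + z) = volume A := by
    rw [lintegral_add_right_eq_self fun x => A.indicator (1 : Plane → ℝ≥0∞) x,
      lintegral_indicator_one hA]
  have hf : Measurable f := measurable_from_prod_countable_right fun i =>
    (hAm.const_mul (p i)).mul_const (q i)
  have hfint : ∫⁻ x, f x ∂(typedIntensity lam) ≠ ∞ := by
    rw [lintegral_typedIntensity lam hf]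
    refine (ENNReal.sum_lt_top.2 fun i _ => ENNReal.mul_lt_top ENNReal.ofReal_lt_top ?_).ne
    simp only [f]
    rw [lintegral_mul_const _ (hAm.const_mul _), lintegral_const_mul _ hAm, hAint]
    exact ENNReal.mul_lt_top (ENNReal.mul_lt_top (hp i).lt_top hA'.lt_top) (hqtop i).lt_top
  have hgm : Measurable fun x : Fin M × Plane => f x * expNeg (v x.1 ‖z‖ₑ) :=
    hf.mul (measurable_expNeg.comp (measurable_from_prod_countable_right fun i =>
      (measurable_const : Measurable fun _ : Plane => v i ‖z‖ₑ)))
  have key := hN.mecke_radial hf hfint hv hvc z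
  rw [lintegral_typedIntensity lam hgm] at key
  have hcongr : ∀ ω l, p l.1 * A.indicator 1 (N.txOf l ω + z) *
      expNeg (∑' k : Link M, if k ≠ l then v k.1 ‖N.txOf k ω - (N.txOf l ω + z)‖ₑ else 0) =
      f (N.typedTx l ω) *
        expNeg (∑' k : Link M, v k.1 ‖N.txOf k ω - (N.txOf l ω + z)‖ₑ) := by
    intro ω l
    rw [tsum_eq_add_tsum_ne (fun k : Link M => v k.1 ‖N.txOf k ω - (N.txOf l ω + z)‖ₑ) l,
      sub_add_cancel_left, enorm_neg, expNeg_add]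
    change _ = p l.1 * A.indicator 1 (N.txOf l ω + z) * q l.1 * _
    rw [mul_assoc (p l.1 * _) (q l.1), ← mul_assoc (q l.1), hq, one_mul]
  simp_rw [hcongr]
  rw [key]
  congr 1
  rw [Finset.sum_mul]
  refine Finset.sum_congr rfl fun i _ => ?_
  simp only [f, mul_assoc, hq, mul_one]
  rw [lintegral_const_mul _ hAm, hAint]

end Network

end Mecke

/-! ### Integrals in the plane -/

/-- Integration of radial functions in polar coordinates. -/
lemma lintegral_norm_plane {f : ℝ → ℝ≥0∞} (hf : Measurable f) :
    ∫⁻ x : Plane, f ‖x‖ =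
      ENNReal.ofReal (2 * Real.pi) * ∫⁻ r in Set.Ioi (0 : ℝ), ENNReal.ofReal r * f r := by
  have hfv : Measurable fun r : Set.Ioi (0 : ℝ) => f r := hf.comp measurable_subtype_coe
  calc ∫⁻ x : Plane, f ‖x‖
      = ∫⁻ x : ({(0 : Plane)}ᶜ : Set Plane), f ‖x.1‖ ∂((volume : Measure Plane).comap (↑)) := by
        rw [lintegral_subtype_comap (measurableSet_singleton _).compl fun x : Plane => f ‖x‖,
          restrict_compl_singleton]
    _ = ∫⁻ p, f p.2 ∂((volume : Measure Plane).toSphere.prod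
          (Measure.volumeIoiPow (Module.finrank ℝ Plane - 1))) := by
        simpa using (volume : Measure Plane).measurePreserving_homeomorphUnitSphereProd.lintegral_comp_emb
          (Homeomorph.measurableEmbedding _) fun p => f p.2
    _ = (volume : Measure Plane).toSphere Set.univ *
          ∫⁻ r, f r ∂(Measure.volumeIoiPow (Module.finrank ℝ Plane - 1)) := by
        rw [lintegral_prod
          (fun p : Metric.sphere (0 : Plane) 1 × Set.Ioi (0 : ℝ) => f p.2)
          (hfv.comp measurable_snd).aemeasurable]
        simp only [lintegral_const]
        rw [mul_comm]
    _ = _ := by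
        -- The circle has mass dimension times area of the unit disc, that is `2π`.
        rw [Measure.toSphere_apply_univ, Measure.volumeIoiPow,
          lintegral_withDensity_eq_lintegral_mul _ (by fun_prop) hfv]
        congr 1
        · simp [EuclideanSpace.volume_ball_fin_two, ENNReal.ofReal_mul]
        · rw [← lintegral_subtype_comap measurableSet_Ioi fun r : ℝ => ENNReal.ofReal r * f r]
          simp

/-- Writing `1 / (r ^ α + t)` as the integral of `exp (-h (r ^ α + t))` over `h > 0` and exchanging
the integrals produces `Γ(2/α) Γ(1 - 2/α)`, which the reflection formula evaluates. -/
lemma lintegral_Ioi_mul_div_rpow_add {α t : ℝ} (hα : 2 < α) (ht : 0 < t) :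
    ∫⁻ r in Set.Ioi (0 : ℝ), ENNReal.ofReal (r * (t / (r ^ α + t))) =
      ENNReal.ofReal (t ^ (2 / α) * (Real.pi / Real.sin (2 * Real.pi / α) / α)) := by
  have hα0 : 0 < α := by linarith
  have h2α : 2 / α < 1 := by rw [div_lt_one hα0]; exact hα
  have h2α0 : 0 < 2 / α := by positivity
  have hinner : ∀ r ∈ Set.Ioi (0 : ℝ), ENNReal.ofReal (r * (t / (r ^ α + t))) =
      ∫⁻ h in Set.Ioi (0 : ℝ), ENNReal.ofReal (t * (r * Real.exp (-h * (r ^ α + t)))) := by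
    intro r hr
    have hr : 0 < r := hr
    have hb : 0 < r ^ α + t := by positivity
    have h1 := integrableOn_exp_mul_Ioi (neg_lt_zero.2 hb) 0
    have h2 := integral_exp_mul_Ioi (neg_lt_zero.2 hb) 0
    have e : ∀ h : ℝ, t * (r * Real.exp (-h * (r ^ α + t))) =
        t * r * Real.exp (-(r ^ α + t) * h) := fun h => by
      rw [mul_assoc]; congr 3; ring
    simp_rw [e]
    rw [← ofReal_integral_eq_lintegral_ofReal (h1.const_mul _)
      (Eventually.of_forall fun h => by positivity), integral_const_mul, h2]
    congr 1
    rw [mul_zero, Real.exp_zero, neg_div_neg_eq]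
    ring
  have houter : ∀ h ∈ Set.Ioi (0 : ℝ),
      ∫⁻ r in Set.Ioi (0 : ℝ), ENNReal.ofReal (t * (r * Real.exp (-h * (r ^ α + t)))) =
      ENNReal.ofReal (t * (1 / α * Real.Gamma (2 / α)) *
        (h ^ (1 - 2 / α - 1) * Real.exp (-(t * h)))) := by
    intro h hh
    have hh : 0 < h := hh
    have h1 := integrableOn_rpow_mul_exp_neg_mul_rpow (s := 1) (p := α) (b := h) (by norm_num)
      hα0 hh
    have h2 := integral_rpow_mul_exp_neg_mul_rpow (q := 1) (p := α) (b := h) hα0 (by norm_num) hh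
    have e : ∀ r : ℝ, t * (r * Real.exp (-h * (r ^ α + t))) =
        t * Real.exp (-(t * h)) * (r ^ (1 : ℝ) * Real.exp (-h * r ^ α)) := fun r => by
      rw [Real.rpow_one, mul_add, Real.exp_add]
      ring_nf
    simp_rw [e]
    rw [← ofReal_integral_eq_lintegral_ofReal (h1.const_mul _), integral_const_mul, h2]
    · congr 1
      rw [show -(1 + 1 : ℝ) / α = 1 - 2 / α - 1 by ring, show (1 + 1 : ℝ) / α = 2 / α by ring]
      ring
    · filter_upwards [ae_restrict_mem measurableSet_Ioi] with r hr
      have hr : 0 < r := hr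
      positivity
  rw [setLIntegral_congr_fun measurableSet_Ioi hinner, lintegral_lintegral_swap (by fun_prop),
    setLIntegral_congr_fun measurableSet_Ioi houter]
  have h1 := integrableOn_rpow_mul_exp_neg_mul_rpow (s := 1 - 2 / α - 1) (p := 1) (b := t)
    (by linarith) one_pos ht
  simp only [Real.rpow_one, neg_mul] at h1
  have hΓ := Real.Gamma_pos_of_pos h2α0
  rw [← ofReal_integral_eq_lintegral_ofReal (h1.const_mul _), integral_const_mul,
    Real.integral_rpow_mul_exp_neg_mul_Ioi (by linarith) ht]
  · congr 1
    have hrefl := Real.Gamma_mul_Gamma_one_sub (2 / α)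
    rw [show Real.pi * (2 / α) = 2 * Real.pi / α by ring] at hrefl
    rw [← hrefl, one_div t, Real.inv_rpow ht.le, ← Real.rpow_neg ht.le,
      show -(1 - 2 / α) = 2 / α - 1 by ring, Real.rpow_sub ht, Real.rpow_one]
    field_simp
  · filter_upwards [ae_restrict_mem measurableSet_Ioi] with h hh
    have hh : 0 < h := hh
    positivity

/-- The mean of the factor `exp (-t h ‖y‖^(-α))` with exponentially distributed `h`, for a
transmitter at distance `d` that is active with probability `p`. -/
def linkFactor (p α : ℝ) (t d : ℝ≥0∞) : ℝ≥0∞ :=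
  ENNReal.ofReal (1 - p) + ENNReal.ofReal p * (1 + t * d ^ (-α))⁻¹

lemma linkFactor_le_one {p α : ℝ} (hp : p ∈ Set.Icc (0 : ℝ) 1) (t d : ℝ≥0∞) :
    linkFactor p α t d ≤ 1 := by
  calc linkFactor p α t d ≤ ENNReal.ofReal (1 - p) + ENNReal.ofReal p * 1 := by
        unfold linkFactor
        gcongr
        rw [ENNReal.inv_le_one]
        exact le_self_add
    _ = 1 := by
        rw [mul_one, ← ENNReal.ofReal_add (by linarith [hp.2]) hp.1]
        simp

/-- At distance `r > 0` the integrand is `p t / (r ^ α + t)`, so polar coordinates reduce this to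
the preceding integral. -/
lemma lintegral_one_sub_linkFactor {p α t : ℝ} (hp : p ∈ Set.Icc (0 : ℝ) 1) (hα : 2 < α)
    (ht : 0 ≤ t) :
    ∫⁻ y : Plane, 1 - linkFactor p α (ENNReal.ofReal t) ‖y‖ₑ =
      ENNReal.ofReal (p * ((2 * Real.pi ^ 2 / α) / Real.sin (2 * Real.pi / α)) * t ^ (2 / α)) := by
  have hα0 : 0 < α := by linarith
  have h2α0 : 0 < 2 / α := by positivity
  rcases ht.eq_or_lt with rfl | ht
  · have : ∀ y : Plane, 1 - linkFactor p α (ENNReal.ofReal 0) ‖y‖ₑ = 0 := by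
      intro y
      rw [linkFactor, ENNReal.ofReal_zero, zero_mul, add_zero, inv_one, mul_one,
        ← ENNReal.ofReal_add (by linarith [hp.2]) hp.1]
      simp
    rw [lintegral_congr this, Real.zero_rpow h2α0.ne']
    simp
  · have hm : Measurable fun r : ℝ => 1 - linkFactor p α (ENNReal.ofReal t) (ENNReal.ofReal r) := by
      unfold linkFactor; fun_prop
    have hnorm : ∀ y : Plane, ‖y‖ₑ = ENNReal.ofReal ‖y‖ := fun y => (ofReal_norm y).symm
    simp_rw [hnorm]
    rw [lintegral_norm_plane hm]
    have hval : ∀ r ∈ Set.Ioi (0 : ℝ),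
        ENNReal.ofReal r * (1 - linkFactor p α (ENNReal.ofReal t) (ENNReal.ofReal r)) =
        ENNReal.ofReal p * ENNReal.ofReal (r * (t / (r ^ α + t))) := by
      intro r hr
      have hr : 0 < r := hr
      have hb : 0 < r ^ α := by positivity
      rw [linkFactor, ENNReal.ofReal_rpow_of_pos hr, ← ENNReal.ofReal_mul ht.le,
        ← ENNReal.ofReal_one, ← ENNReal.ofReal_add zero_le_one (by positivity),
        ← ENNReal.ofReal_inv_of_pos (by positivity), ← ENNReal.ofReal_mul hp.1,
        ← ENNReal.ofReal_add (by linarith [hp.2]) (mul_nonneg hp.1 (by positivity)),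
        ← ENNReal.ofReal_sub, ← ENNReal.ofReal_mul hr.le, ← ENNReal.ofReal_mul hp.1]
      · congr 1
        rw [Real.rpow_neg hr.le]
        field_simp
        ring
      · exact add_nonneg (by linarith [hp.2]) (mul_nonneg hp.1 (by positivity))
    rw [setLIntegral_congr_fun measurableSet_Ioi hval, lintegral_const_mul _ (by fun_prop),
      lintegral_Ioi_mul_div_rpow_add hα ht, ← ENNReal.ofReal_mul hp.1,
      ← ENNReal.ofReal_mul (by positivity)]
    congr 1
    ring

/-! ### The exponential distribution -/

lemma lintegral_expMeasure_one {f : ℝ → ℝ≥0∞} (hf : Measurable f) :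
    ∫⁻ x, f x ∂(expMeasure 1) = ∫⁻ x in Set.Ici (0 : ℝ), ENNReal.ofReal (Real.exp (-x)) * f x := by
  have hm : Measurable (exponentialPDF 1) := by unfold exponentialPDF; fun_prop
  have : expMeasure 1 = volume.withDensity (exponentialPDF 1) := rfl
  rw [this, lintegral_withDensity_eq_lintegral_mul _ hm hf, ← lintegral_indicator measurableSet_Ici]
  refine lintegral_congr fun x => ?_
  by_cases hx : 0 ≤ x <;> simp [exponentialPDF_eq, hx]

lemma lintegral_expNeg_expMeasure (c : ℝ≥0∞) :
    ∫⁻ x, expNeg (c * ENNReal.ofReal x) ∂(expMeasure 1) = (1 + c)⁻¹ := by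
  -- The point `0` is discarded because there `∞ * 0 = 0` makes the integrand nonzero even for `c =
  -- ∞`.
  rw [lintegral_expMeasure_one (by fun_prop), setLIntegral_congr Ioi_ae_eq_Ici.symm]
  induction c with
  | top =>
    rw [setLIntegral_congr_fun measurableSet_Ioi (g := 0)]
    · simp
    · intro x hx
      have hx : 0 < x := hx
      simp [ENNReal.top_mul, hx]
  | coe c =>
    have h1 := integrableOn_exp_mul_Ioi (a := -(1 + c : ℝ)) (by linarith [c.coe_nonneg]) 0
    have h2 := integral_exp_mul_Ioi (a := -(1 + c : ℝ)) (by linarith [c.coe_nonneg]) 0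
    have hval : ∀ x ∈ Set.Ioi (0 : ℝ),
        ENNReal.ofReal (Real.exp (-x)) * expNeg (c * ENNReal.ofReal x) =
        ENNReal.ofReal (Real.exp (-(1 + c : ℝ) * x)) := by
      intro x hx
      have hx : 0 < x := hx
      rw [← ENNReal.ofReal_coe_nnreal, ← ENNReal.ofReal_mul c.coe_nonneg,
        expNeg_ofReal (mul_nonneg c.coe_nonneg hx.le), ← ENNReal.ofReal_mul (Real.exp_pos _).le,
        ← Real.exp_add]
      congr 2
      ring
    rw [setLIntegral_congr_fun measurableSet_Ioi hval,
      ← ofReal_integral_eq_lintegral_ofReal h1 (Eventually.of_forall fun _ => (Real.exp_pos _).le),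
      h2, ← ENNReal.ofReal_coe_nnreal, ← ENNReal.ofReal_one, ← ENNReal.ofReal_add zero_le_one c.coe_nonneg,
      ← ENNReal.ofReal_inv_of_pos (by linarith [c.coe_nonneg])]
    congr 1
    rw [mul_zero, Real.exp_zero, neg_div_neg_eq, one_div]

lemma expMeasure_lt_ofReal (c : ℝ≥0∞) :
    expMeasure 1 {x | c < ENNReal.ofReal x} = expNeg c := by
  induction c with
  | top => simp
  | coe c =>
    have : {x : ℝ | (c : ℝ≥0∞) < ENNReal.ofReal x} = (Set.Iic (c : ℝ))ᶜ := by
      ext x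
      simp only [Set.mem_ofPred_eq, Set.mem_compl_iff, Set.mem_Iic, not_le]
      rw [← ENNReal.ofReal_coe_nnreal, ENNReal.ofReal_lt_ofReal_iff_of_nonneg c.coe_nonneg]
    have := isProbabilityMeasure_expMeasure one_pos
    rw [‹{x : ℝ | (c : ℝ≥0∞) < ENNReal.ofReal x} = _›, prob_compl_eq_one_sub measurableSet_Iic,
      ← ofReal_cdf, cdf_expMeasure_eq one_pos, if_pos c.coe_nonneg, ← ENNReal.ofReal_one,
      ← ENNReal.ofReal_sub, ← ENNReal.ofReal_coe_nnreal, expNeg_ofReal c.coe_nonneg]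
    · simp
    · rw [sub_nonneg, Real.exp_le_one_iff, one_mul]
      exact neg_nonpos.2 c.coe_nonneg

/-! ### The Gaussian distribution of the plane -/

lemma lintegral_stdGaussian_plane {f : Plane → ℝ≥0∞} (hf : Measurable f) :
    ∫⁻ x, f x ∂(stdGaussian Plane) =
      ∫⁻ x, f x * ENNReal.ofReal ((2 * Real.pi)⁻¹ * Real.exp (-(‖x‖ ^ 2 / 2))) := by
  let g : ℝ → ℝ≥0∞ := gaussianPDF 0 1
  have hg : Measurable g := measurable_gaussianPDF 0 1
  have hgauss : gaussianReal 0 1 = volume.withDensity g := gaussianReal_of_var_ne_zero _ one_ne_zero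
  have hpi : Measure.pi (fun _ : Fin 2 => gaussianReal 0 1) =
      (volume : Measure (Fin 2 → ℝ)).withDensity fun x => g (x 0) * g (x 1) := by
    have h1 := measurePreserving_finTwoArrow (gaussianReal 0 1)
    have h2 := volume_preserving_finTwoArrow ℝ
    refine Measure.ext_of_lintegral _ fun F hF => ?_
    have e : ∀ x, F x = F (MeasurableEquiv.finTwoArrow.symm (MeasurableEquiv.finTwoArrow x)) :=
      fun x => by rw [MeasurableEquiv.symm_apply_apply]
    have hF' : Measurable fun p => F ((MeasurableEquiv.finTwoArrow (α := ℝ)).symm p) :=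
      hF.comp (MeasurableEquiv.measurable _)
    rw [lintegral_withDensity_eq_lintegral_mul _ (by fun_prop) hF, lintegral_congr e,
      h1.lintegral_comp hF', hgauss, prod_withDensity hg hg,
      lintegral_withDensity_eq_lintegral_mul _ (by fun_prop) hF', ← Measure.volume_eq_prod,
      ← h2.lintegral_comp (by fun_prop)]
    refine lintegral_congr fun x => ?_
    simp only [Pi.mul_apply]
    rw [← e]
    rfl
  have hpl := PiLp.volume_preserving_toLp (Fin 2)
  rw [← map_pi_eq_stdGaussian, lintegral_map hf hpl.measurable, hpi,
    lintegral_withDensity_eq_lintegral_mul (g := fun x => f (WithLp.toLp 2 x)) _ (by fun_prop)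
      (hf.comp hpl.measurable),
    ← hpl.lintegral_comp (by fun_prop)]
  refine lintegral_congr fun x => ?_
  simp only [Pi.mul_apply, g]
  rw [mul_comm, gaussianPDF, gaussianPDF, ← ENNReal.ofReal_mul (gaussianPDFReal_nonneg _ _ _)]
  congr 2
  rw [gaussianPDFReal, gaussianPDFReal, EuclideanSpace.real_norm_sq_eq]
  simp only [Fin.sum_univ_two, NNReal.coe_one, mul_one, sub_zero]
  rw [mul_mul_mul_comm, ← Real.exp_add, ← mul_inv, Real.mul_self_sqrt (by positivity)]
  congr 2
  ring

/-- The norm of a centred Gaussian vector of the plane with independent coordinates of variance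
`δ ^ 2` has the Rayleigh distribution. -/
lemma lintegral_norm_gaussian {δ : ℝ} (hδ : 0 < δ) {f : ℝ → ℝ≥0∞} (hf : Measurable f) :
    ∫⁻ x, f ‖x‖ ∂((stdGaussian Plane).map fun x => δ • x) =
      ∫⁻ v in Set.Ioi (0 : ℝ),
        f v * ENNReal.ofReal (v * Real.exp (-(v ^ 2 / (2 * δ ^ 2))) / δ ^ 2) := by
  let H : ℝ → ℝ≥0∞ := fun r =>
    f r * ENNReal.ofReal ((2 * Real.pi)⁻¹ * Real.exp (-(r ^ 2 / (2 * δ ^ 2))))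
  have hH : Measurable H := by fun_prop
  have h1 : ∀ x : Plane, f ‖δ • x‖ *
      ENNReal.ofReal ((2 * Real.pi)⁻¹ * Real.exp (-(‖x‖ ^ 2 / 2))) = H ‖δ • x‖ := by
    intro x
    simp only [H, norm_smul, Real.norm_eq_abs, abs_of_pos hδ, mul_pow]
    congr 5
    field_simp
  -- The planar change of variables has Jacobian `δ⁻²`; the `2π` of polar coordinates later cancels
  -- the Gaussian constant.
  have h2 : ∫⁻ x : Plane, H ‖δ • x‖ = ENNReal.ofReal ((δ ^ 2)⁻¹) * ∫⁻ x : Plane, H ‖x‖ := by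
    rw [← lintegral_map (f := fun x : Plane => H ‖x‖) (g := fun x => δ • x) (by fun_prop)
      (by fun_prop), Measure.map_addHaar_smul _ hδ.ne', lintegral_smul_measure]
    simp [abs_of_pos hδ]
  rw [lintegral_map (by fun_prop) (by fun_prop), lintegral_stdGaussian_plane (by fun_prop)]
  simp_rw [h1]
  rw [h2, lintegral_norm_plane hH, ← mul_assoc, ← ENNReal.ofReal_mul (by positivity),
    ← lintegral_const_mul _ (by fun_prop)]
  refine setLIntegral_congr_fun measurableSet_Ioi fun v hv => ?_
  have hv : 0 < v := hv
  simp only [H]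
  rw [mul_left_comm (ENNReal.ofReal v), mul_left_comm, ← ENNReal.ofReal_mul hv.le,
    ← ENNReal.ofReal_mul (by positivity)]
  congr 2
  field_simp

/-! ### Integrating out independent marks -/

section Marks

variable {Ω : Type*} [MeasurableSpace Ω] {μ : Measure Ω} [IsProbabilityMeasure μ]

lemma lintegral_comp_of_indepFun {E S : Type*} [MeasurableSpace E] [MeasurableSpace S]
    {X : Ω → E} {Y : Ω → S} (hX : Measurable X) (hY : Measurable Y) (h : IndepFun X Y μ)
    {F : E × S → ℝ≥0∞} (hF : Measurable F) :
    ∫⁻ ω, F (X ω, Y ω) ∂μ = ∫⁻ ω, ∫⁻ x, F (x, Y ω) ∂(μ.map X) ∂μ := by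
  have := Measure.isProbabilityMeasure_map hX.aemeasurable (μ := μ)
  have := Measure.isProbabilityMeasure_map hY.aemeasurable (μ := μ)
  rw [← lintegral_map hF (hX.prodMk hY),
    (indepFun_iff_map_prod_eq_prod_map_map hX.aemeasurable hY.aemeasurable).1 h,
    lintegral_prod_symm _ hF.aemeasurable, lintegral_map hF.lintegral_prod_left' hY]

/-- Marks are averaged one at a time given `τ` and the remaining ones. The averaged factor is a
function of `τ` alone and is absorbed into `f`, over which the induction is therefore generalised.
-/
lemma lintegral_prod_of_indep_marks {ι E S : Type*} [MeasurableSpace E] [MeasurableSpace S]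
    {τ : Ω → S} {X : ι → Ω → E} (hτ : Measurable τ) (hX : ∀ k, Measurable (X k))
    (hind : ∀ (F : Finset ι) (a : ι), a ∉ F →
      IndepFun (X a) (fun ω => (τ ω, fun k : F => X k ω)) μ)
    {φ : ι → E × S → ℝ≥0∞} (hφ : ∀ k, Measurable (φ k)) (F : Finset ι) {f : S → ℝ≥0∞}
    (hf : Measurable f) :
    ∫⁻ ω, f (τ ω) * ∏ k ∈ F, φ k (X k ω, τ ω) ∂μ =
      ∫⁻ ω, f (τ ω) * ∏ k ∈ F, ∫⁻ x, φ k (x, τ ω) ∂(μ.map (X k)) ∂μ := by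
  classical
  induction F using Finset.induction_on generalizing f with
  | empty => simp
  | insert a F ha ih =>
    have := Measure.isProbabilityMeasure_map (hX a).aemeasurable (μ := μ)
    let G : E × S × (F → E) → ℝ≥0∞ := fun p =>
      φ a (p.1, p.2.1) * (f p.2.1 * ∏ k : F, φ k (p.2.2 k, p.2.1))
    have hG : Measurable G := by
      refine ((hφ a).comp (by fun_prop)).mul ((hf.comp (by fun_prop)).mul ?_)
      exact Finset.measurable_prod _ fun k _ => (hφ k).comp (by fun_prop)
    have hY : Measurable fun ω => (τ ω, fun k : F => X k ω) :=
      hτ.prodMk (measurable_pi_lambda _ fun k => hX k)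
    have hφa : Measurable fun t => ∫⁻ x, φ a (x, t) ∂(μ.map (X a)) := (hφ a).lintegral_prod_left'
    calc ∫⁻ ω, f (τ ω) * ∏ k ∈ insert a F, φ k (X k ω, τ ω) ∂μ
        = ∫⁻ ω, G (X a ω, τ ω, fun k : F => X k ω) ∂μ := by
          refine lintegral_congr fun ω => ?_
          simp only [G]
          rw [Finset.prod_insert ha, Finset.prod_coe_sort F fun k => φ k (X k ω, τ ω)]
          ring
      _ = ∫⁻ ω, ((∫⁻ x, φ a (x, τ ω) ∂(μ.map (X a))) * f (τ ω)) *
            ∏ k ∈ F, φ k (X k ω, τ ω) ∂μ := by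
          rw [lintegral_comp_of_indepFun (hX a) hY (hind F a ha) hG]
          refine lintegral_congr fun ω => ?_
          simp only [G]
          rw [lintegral_mul_const (f := fun x => φ a (x, τ ω)) _ ((hφ a).comp (by fun_prop)),
            Finset.prod_coe_sort F fun k => φ k (X k ω, τ ω), mul_assoc]
      _ = _ := by
          rw [ih (f := fun t => (∫⁻ x, φ a (x, t) ∂(μ.map (X a))) * f t) (hφa.mul hf)]
          refine lintegral_congr fun ω => ?_
          rw [Finset.prod_insert ha]
          ring

end Marks

/-! ### Sources of randomness and the marks of a link -/

namespace Network

variable {M : ℕ} {Ω : Type*}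

/-- The interference at the receiver of `l` depends measurably on the random elements of the
network other than the fading coefficient of the link `l`. -/
lemma measurable_interference [MeasurableSpace Ω] {N : Network M Ω} {l : Link M} (P α : ℝ)
    (htx : ∀ k, Measurable (N.txOf k)) (htime : ∀ k, Measurable (N.timeHop k))
    (hfreq : ∀ k, Measurable (N.freqHop k)) (hoff : Measurable (N.offset l))
    (hfad : ∀ k, k ≠ l → Measurable (N.fading k l)) : Measurable (N.interference P α l) := by
  classical
  refine Measurable.tsum fun k => ?_
  by_cases hk : k = l
  · simp [hk]
  · have hact : MeasurableSet {ω | N.Active k ω} :=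
      ((htime k) (measurableSet_singleton true)).inter ((hfreq k) (measurableSet_singleton true))
    simp only [ne_eq, hk, not_false_eq_true, true_and]
    refine Measurable.ite hact ?_ measurable_const
    have h1 := hfad k hk
    have h2 := htx k
    have h3 := htx l
    unfold rxPower rxOf
    fun_prop

section SigmaOf

variable {N : Network M Ω}

/-- The σ-algebra that a set of sources of randomness generates. -/
@[reducible] def sigmaOf (N : Network M Ω) (S : Set (Source M)) : MeasurableSpace Ω :=
  ⨆ s ∈ S, N.sigma s

lemma sigma_le_sigmaOf {S : Set (Source M)} {s : Source M} (hs : s ∈ S) :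
    N.sigma s ≤ N.sigmaOf S :=
  le_iSup₂_of_le s hs le_rfl

lemma measurable_sigmaOf_points {S : Set (Source M)} {i : Fin M} (hs : Source.points i ∈ S) :
    Measurable[N.sigmaOf S] fun ω n => N.tx i n ω :=
  measurable_iff_comap_le.2 (sigma_le_sigmaOf hs)

lemma measurable_sigmaOf_timeHop {S : Set (Source M)} {k : Link M} (hs : Source.timeHop k ∈ S) :
    Measurable[N.sigmaOf S] (N.timeHop k) :=
  measurable_iff_comap_le.2 (sigma_le_sigmaOf hs)

lemma measurable_sigmaOf_freqHop {S : Set (Source M)} {k : Link M} (hs : Source.freqHop k ∈ S) :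
    Measurable[N.sigmaOf S] (N.freqHop k) :=
  measurable_iff_comap_le.2 (sigma_le_sigmaOf hs)

lemma measurable_sigmaOf_offset {S : Set (Source M)} {k : Link M} (hs : Source.offset k ∈ S) :
    Measurable[N.sigmaOf S] (N.offset k) :=
  measurable_iff_comap_le.2 (sigma_le_sigmaOf hs)

lemma measurable_sigmaOf_fading {S : Set (Source M)} {k l : Link M}
    (hs : Source.fading k l ∈ S) : Measurable[N.sigmaOf S] (N.fading k l) :=
  measurable_iff_comap_le.2 (sigma_le_sigmaOf hs)

lemma measurable_sigmaOf_txOf {S : Set (Source M)} {k : Link M} (hs : Source.points k.1 ∈ S) :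
    Measurable[N.sigmaOf S] (N.txOf k) :=
  (measurable_pi_apply k.2).comp (measurable_sigmaOf_points hs)

end SigmaOf

variable [mΩ : MeasurableSpace Ω] {μ : Measure Ω} {N : Network M Ω} {lam pt pf : Fin M → ℝ} {δ : ℝ}

lemma IsModel.measurable_points (hN : N.IsModel lam pt pf δ μ) (i : Fin M) :
    Measurable fun ω n => N.tx i n ω :=
  measurable_pi_lambda _ fun n => (hN.poisson i).measurable_point n

lemma IsModel.sigma_le (hN : N.IsModel lam pt pf δ μ) : ∀ s, N.sigma s ≤ mΩ
  | .points i => (hN.measurable_points i).comap_le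
  | .timeHop k => (hN.measurable_timeHop k).comap_le
  | .freqHop k => (hN.measurable_freqHop k).comap_le
  | .offset k => (hN.measurable_offset k).comap_le
  | .fading k l => (hN.measurable_fading k l).comap_le

/-- Reduces independence of derived quantities to disjointness of the sets of sources they use. -/
lemma IsModel.indepFun_of_disjoint (hN : N.IsModel lam pt pf δ μ) {S T : Set (Source M)}
    (hST : Disjoint S T) {E F : Type*} [MeasurableSpace E] [MeasurableSpace F] {f : Ω → E}
    {g : Ω → F} (hf : Measurable[N.sigmaOf S] f) (hg : Measurable[N.sigmaOf T] g) :
    IndepFun f g μ :=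
  indep_of_indep_of_le_right (indep_of_indep_of_le_left
    (indep_iSup_of_disjoint hN.sigma_le hN.indep hST) (measurable_iff_comap_le.1 hf))
    (measurable_iff_comap_le.1 hg)

/-- The marks of the link `k` that are relevant to its interference at the receiver of `l`. -/
def mark (N : Network M Ω) (l k : Link M) (ω : Ω) : Bool × Bool × ℝ :=
  (N.timeHop k ω, N.freqHop k ω, N.fading k l ω)

lemma IsModel.measurable_mark (hN : N.IsModel lam pt pf δ μ) (l k : Link M) :
    Measurable (N.mark l k) :=
  (hN.measurable_timeHop k).prodMk ((hN.measurable_freqHop k).prodMk (hN.measurable_fading k l))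

/-- The locations that determine the distances to the receiver of `l`. -/
def geometry (N : Network M Ω) (l : Link M) (ω : Ω) : (Fin M → ℕ → Plane) × Plane :=
  (fun i n => N.tx i n ω, N.offset l ω)

lemma IsModel.measurable_geometry (hN : N.IsModel lam pt pf δ μ) (l : Link M) :
    Measurable (N.geometry l) :=
  (measurable_pi_lambda _ fun i => hN.measurable_points i).prodMk (hN.measurable_offset l)

lemma IsModel.indepFun_mark (hN : N.IsModel lam pt pf δ μ) (l : Link M) (F : Finset (Link M))
    (a : Link M) (ha : a ∉ F) :
    IndepFun (N.mark l a) (fun ω => (N.geometry l ω, fun k : F => N.mark l k ω)) μ := by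
  let S : Set (Source M) := {.timeHop a, .freqHop a, .fading a l}
  have hS : ∀ k : F, (k : Link M) ≠ a := fun k hk => ha (hk ▸ k.2)
  refine hN.indepFun_of_disjoint (disjoint_compl_right (a := S)) ?_ ?_
  · exact (measurable_sigmaOf_timeHop (by simp [S])).prodMk
      ((measurable_sigmaOf_freqHop (by simp [S])).prodMk (measurable_sigmaOf_fading (by simp [S])))
  · refine Measurable.prodMk (Measurable.prodMk ?_ (measurable_sigmaOf_offset (by simp [S]))) ?_
    · exact @measurable_pi_lambda _ _ _ (N.sigmaOf Sᶜ) _ _ fun i =>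
        measurable_sigmaOf_points (by simp [S])
    · exact @measurable_pi_lambda _ _ _ (N.sigmaOf Sᶜ) _ _ fun k =>
        (measurable_sigmaOf_timeHop (by simp [S, hS k])).prodMk
          ((measurable_sigmaOf_freqHop (by simp [S, hS k])).prodMk
            (measurable_sigmaOf_fading (by simp [S, hS k])))

variable [IsProbabilityMeasure μ]

lemma lintegral_bool_law {X : Ω → Bool} (hX : Measurable X) {p : ℝ} (hp : p ∈ Set.Icc (0 : ℝ) 1)
    (h : μ {ω | X ω = true} = ENNReal.ofReal p) (g : Bool → ℝ≥0∞) :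
    ∫⁻ b, g b ∂(μ.map X) = g true * ENNReal.ofReal p + g false * ENNReal.ofReal (1 - p) := by
  have h1 : μ.map X {true} = ENNReal.ofReal p := by
    rw [Measure.map_apply hX (measurableSet_singleton _), ← h]; rfl
  have h2 : μ.map X {false} = ENNReal.ofReal (1 - p) := by
    have := Measure.isProbabilityMeasure_map hX.aemeasurable (μ := μ)
    have hc : ({false} : Set Bool) = {true}ᶜ := by ext b; cases b <;> simp
    rw [hc, prob_compl_eq_one_sub (measurableSet_singleton _), h1, ← ENNReal.ofReal_one,
      ENNReal.ofReal_sub _ hp.1]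
  rw [lintegral_fintype, Fintype.sum_bool, h1, h2]

/-- The two hopping decisions and the fading are independent, so a link is active with probability
`pt * pf`, and its fading is still exponential given activity. -/
lemma IsModel.lintegral_mark (hN : N.IsModel lam pt pf δ μ)
    (hpt : ∀ i, pt i ∈ Set.Icc (0 : ℝ) 1) (hpf : ∀ i, pf i ∈ Set.Icc (0 : ℝ) 1) (l k : Link M)
    {g : ℝ → ℝ≥0∞} (hg : Measurable g) (b : ℝ≥0∞) :
    ∫⁻ x, (if x.1 = true ∧ x.2.1 = true then g x.2.2 else b) ∂(μ.map (N.mark l k)) =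
      ENNReal.ofReal (1 - pt k.1 * pf k.1) * b +
        ENNReal.ofReal (pt k.1 * pf k.1) * ∫⁻ h, g h ∂(expMeasure 1) := by
  have htm := hN.measurable_timeHop k
  have hfm := hN.measurable_freqHop k
  have hhm := hN.measurable_fading k l
  have := Measure.isProbabilityMeasure_map htm.aemeasurable (μ := μ)
  have := Measure.isProbabilityMeasure_map hfm.aemeasurable (μ := μ)
  have := isProbabilityMeasure_expMeasure one_pos
  have hi1 : IndepFun (N.timeHop k) (fun ω => (N.freqHop k ω, N.fading k l ω)) μ :=
    hN.indepFun_of_disjoint (S := {.timeHop k}) (T := {.freqHop k, .fading k l}) (by simp)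
      (measurable_sigmaOf_timeHop (by simp))
      ((measurable_sigmaOf_freqHop (by simp)).prodMk (measurable_sigmaOf_fading (by simp)))
  have hi2 : IndepFun (N.freqHop k) (N.fading k l) μ :=
    hN.indepFun_of_disjoint (S := {.freqHop k}) (T := {.fading k l}) (by simp)
      (measurable_sigmaOf_freqHop (by simp)) (measurable_sigmaOf_fading (by simp))
  have hlaw : μ.map (N.mark l k) =
      (μ.map (N.timeHop k)).prod ((μ.map (N.freqHop k)).prod (expMeasure 1)) := by
    rw [← hN.fading_law k l,
      ← (indepFun_iff_map_prod_eq_prod_map_map hfm.aemeasurable hhm.aemeasurable).1 hi2,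
      ← (indepFun_iff_map_prod_eq_prod_map_map htm.aemeasurable
        (hfm.prodMk hhm).aemeasurable).1 hi1]
    rfl
  have hF : Measurable fun x : Bool × Bool × ℝ =>
      if x.1 = true ∧ x.2.1 = true then g x.2.2 else b := by
    refine Measurable.ite ?_ (by fun_prop) measurable_const
    exact (measurable_fst (measurableSet_singleton true)).inter
      ((measurable_fst.comp measurable_snd) (measurableSet_singleton true))
  have hF2 : ∀ t : Bool, Measurable fun x : Bool × ℝ =>
      if t = true ∧ x.1 = true then g x.2 else b := fun t => hF.comp measurable_prodMk_left
  have hpt0 := hpt k.1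
  have hpf0 := hpf k.1
  have hinner : ∀ t : Bool, ∫⁻ x : Bool × ℝ, (if t = true ∧ x.1 = true then g x.2 else b)
      ∂((μ.map (N.freqHop k)).prod (expMeasure 1)) =
      if t = true then (∫⁻ h, g h ∂(expMeasure 1)) * ENNReal.ofReal (pf k.1) +
        b * ENNReal.ofReal (1 - pf k.1) else b := by
    intro t
    rw [lintegral_prod _ (hF2 t).aemeasurable, lintegral_bool_law hfm (hpf k.1) (hN.freqHop_law k)]
    cases t <;> simp [← mul_add, ← ENNReal.ofReal_add hpf0.1 (sub_nonneg.2 hpf0.2)]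
  rw [hlaw, lintegral_prod _ hF.aemeasurable]
  refine (lintegral_congr hinner).trans ?_
  rw [lintegral_bool_law htm (hpt k.1) (hN.timeHop_law k)]
  simp only [if_true, Bool.false_eq_true, if_false]
  have e1 : ENNReal.ofReal (1 - pt k.1 * pf k.1) = ENNReal.ofReal (1 - pf k.1) *
      ENNReal.ofReal (pt k.1) + ENNReal.ofReal (1 - pt k.1) := by
    rw [← ENNReal.ofReal_mul (by linarith [hpf0.2]), ← ENNReal.ofReal_add
      (mul_nonneg (by linarith [hpf0.2]) hpt0.1) (by linarith [hpt0.2])]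
    congr 1; ring
  rw [e1, ENNReal.ofReal_mul hpt0.1]
  ring

end Network

/-- The factor `c` at the index `l` stands for the activity of `l` itself, either as an indicator or
as a probability; every large enough finite set contains `l`. -/
lemma tendsto_mul_prod_expNeg {ι : Type*} [DecidableEq ι] (l : ι) {g c : ℝ≥0∞} (hg : g ≠ ∞)
    (hc : c ≠ ∞) (a : ι → ℝ≥0∞) :
    Tendsto (fun F : Finset ι => g * ∏ k ∈ F, if k = l then c else expNeg (a k)) atTop
      (𝓝 (c * g * expNeg (∑' k, if k ≠ l then a k else 0))) := by
  have h := (tendsto_expNeg_sum fun k => if k ≠ l then a k else 0)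
  have h2 := ENNReal.Tendsto.const_mul (a := c * g) h (Or.inr (ENNReal.mul_ne_top hc hg))
  refine h2.congr' ?_
  filter_upwards [eventually_ge_atTop {l}] with F hF
  have hl : l ∈ F := hF (Finset.mem_singleton_self l)
  rw [← Finset.mul_prod_erase F _ hl, ← Finset.mul_prod_erase F (fun k => ite _ c _) hl]
  simp only [ne_eq, not_true_eq_false, if_false, expNeg_zero, one_mul, if_true]
  rw [mul_comm c g, mul_assoc]
  congr 2
  refine Finset.prod_congr rfl fun k hk => ?_
  simp [Finset.ne_of_mem_erase hk]

/-- The factor can vanish at `d = 0` (for `p = 1`), where the path gain is infinite; away from it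
the own factor may be divided out in `mecke_removed`. -/
lemma linkFactor_ne_zero {p α : ℝ} (hα : 0 < α) {t d : ℝ≥0∞} (ht : t ≠ ∞)
    (hd : d ≠ 0) : linkFactor p α t d ≠ 0 := by
  intro h
  rw [linkFactor, add_eq_zero, ENNReal.ofReal_eq_zero, mul_eq_zero, ENNReal.ofReal_eq_zero,
    ENNReal.inv_eq_zero] at h
  rcases h.2 with h2 | h2
  · linarith [h.1]
  · by_cases hd' : d = ∞
    · simp [hd', ENNReal.top_rpow_of_neg (neg_lt_zero.2 hα)] at h2
    · refine ENNReal.add_ne_top.2 ⟨ENNReal.one_ne_top, ENNReal.mul_ne_top ht ?_⟩ h2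
      exact ENNReal.rpow_ne_top_of_ne_zero hd hd'

lemma linkFactor_monotone {p α : ℝ} (hα : 0 ≤ α) (t : ℝ≥0∞) : Monotone (linkFactor p α t) := by
  intro d e hde
  simp only [linkFactor, ENNReal.rpow_neg]
  gcongr

/-- Continuity holds on all of `[0, ∞]`, the origin included, as `mecke_radial` requires. -/
lemma continuous_linkFactor {p α : ℝ} {t : ℝ≥0∞} (ht : t ≠ ∞) : Continuous (linkFactor p α t) := by
  have h : Continuous fun d : ℝ≥0∞ => 1 + t * d ^ (-α) := continuous_const.add
    ((ENNReal.continuous_const_mul ht).comp ENNReal.continuous_rpow_const)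
  exact (continuous_const (y := ENNReal.ofReal (1 - p))).add
    ((ENNReal.continuous_const_mul ENNReal.ofReal_ne_top).comp h.inv)

/-- The Rayleigh law lives on `(0, ∞)`. This excludes a receiver located at its own transmitter. -/
lemma gaussian_ae_ne_zero {δ : ℝ} (hδ : 0 < δ) :
    ∀ᵐ z ∂((stdGaussian Plane).map fun x => δ • x), z ≠ 0 := by
  have h := lintegral_norm_gaussian hδ (f := ({0} : Set ℝ).indicator 1)
    (measurable_one.indicator (measurableSet_singleton 0))
  rw [setLIntegral_congr_fun (g := 0) measurableSet_Ioi] at h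
  · have e : ∀ x : Plane, ({0} : Set ℝ).indicator (1 : ℝ → ℝ≥0∞) ‖x‖ =
        ({0} : Set Plane).indicator 1 x := fun x => by
      by_cases hx : x = 0 <;> simp [hx]
    simp_rw [e] at h
    rw [lintegral_indicator_one (measurableSet_singleton _)] at h
    rw [ae_iff]
    simpa using h
  · intro v hv
    have hv : 0 < v := hv
    simp [hv.ne']

/-- The locations of all transmitters, and the displacement of one receiver. -/
abbrev Geometry (M : ℕ) : Type := (Fin M → ℕ → Plane) × Plane

/-! ### Conditional means at a single link -/

namespace Network

variable {M : ℕ} {Ω : Type*}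

lemma measurableSet_active_window [MeasurableSpace Ω] {N : Network M Ω} {l : Link M}
    (htx : Measurable (N.txOf l)) (htime : Measurable (N.timeHop l))
    (hfreq : Measurable (N.freqHop l)) (hoff : Measurable (N.offset l)) {A : Set Plane}
    (hA : MeasurableSet A) : MeasurableSet {ω | N.Active l ω ∧ N.rxOf l ω ∈ A} :=
  ((htime (measurableSet_singleton true)).inter (hfreq (measurableSet_singleton true))).inter
    ((htx.add hoff) hA)

variable [mΩ : MeasurableSpace Ω] {μ : Measure Ω} [IsProbabilityMeasure μ]
  {N : Network M Ω} {lam pt pf : Fin M → ℝ} {δ : ℝ}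

open Classical in
/-- The coverage indicator of the link `l` may be replaced by its conditional mean given
everything but the fading coefficient of `l`. -/
lemma IsModel.coverage_link (hN : N.IsModel lam pt pf δ μ) (hδ : 0 < δ) {P α β : ℝ} (hP : 0 < P)
    (hβ : 0 < β) (noise : ℝ) {A : Set Plane} (hA : MeasurableSet A) (l : Link M) :
    ∫⁻ ω, (if N.Active l ω ∧ N.rxOf l ω ∈ A then
        (if ENNReal.ofReal β < N.sinr P α noise l ω then (1 : ℝ≥0∞) else 0) else 0) ∂μ =
      ∫⁻ ω, (if N.Active l ω ∧ N.rxOf l ω ∈ A then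
        expNeg (ENNReal.ofReal (β * P⁻¹) * ‖N.offset l ω‖ₑ ^ α *
          (N.interference P α l ω + ENNReal.ofReal noise)) else 0) ∂μ := by
  let a : Ω → ℝ≥0∞ := {ω | N.Active l ω ∧ N.rxOf l ω ∈ A}.indicator 1
  let Y : Ω → ℝ≥0∞ × ℝ≥0∞ × Plane := fun ω =>
    (a ω, N.interference P α l ω + ENNReal.ofReal noise, N.offset l ω)
  let S : Set (Source M) := {.fading l l}
  -- The interference at `l` omits `k = l`, so `Y` uses every source except `fading l l` and is
  -- independent of it.
  have hYS : Measurable[N.sigmaOf Sᶜ] Y := by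
    have h1 : ∀ k, Measurable[N.sigmaOf Sᶜ] (N.txOf k) := fun k =>
      measurable_sigmaOf_txOf (by simp [S])
    have h2 : ∀ k, Measurable[N.sigmaOf Sᶜ] (N.timeHop k) := fun k =>
      measurable_sigmaOf_timeHop (by simp [S])
    have h3 : ∀ k, Measurable[N.sigmaOf Sᶜ] (N.freqHop k) := fun k =>
      measurable_sigmaOf_freqHop (by simp [S])
    have h4 : Measurable[N.sigmaOf Sᶜ] (N.offset l) := measurable_sigmaOf_offset (by simp [S])
    have h5 : ∀ k, k ≠ l → Measurable[N.sigmaOf Sᶜ] (N.fading k l) := fun k hk =>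
      measurable_sigmaOf_fading (by simp [S, hk])
    refine Measurable.prodMk ?_ (Measurable.prodMk (Measurable.add_const ?_ _) h4)
    · exact Measurable.indicator (@measurable_const _ _ _ (N.sigmaOf Sᶜ) 1)
        (@measurableSet_active_window _ _ (N.sigmaOf Sᶜ) _ _ (h1 l) (h2 l) (h3 l) h4 _ hA)
    · exact @measurable_interference _ _ (N.sigmaOf Sᶜ) _ _ P α h1 h2 h3 h4 h5
  have hY : Measurable Y := hYS.mono (iSup₂_le fun s _ => hN.sigma_le s) le_rfl
  have hind : IndepFun (N.fading l l) Y μ :=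
    hN.indepFun_of_disjoint (disjoint_compl_right (a := S))
      (measurable_sigmaOf_fading (by simp [S])) hYS
  let F : ℝ × ℝ≥0∞ × ℝ≥0∞ × Plane → ℝ≥0∞ := fun p =>
    p.2.1 * {q : ℝ × ℝ≥0∞ × ℝ≥0∞ × Plane | ENNReal.ofReal β <
      ENNReal.ofReal P * ENNReal.ofReal q.1 * ‖q.2.2.2‖ₑ ^ (-α) / q.2.2.1}.indicator 1 p
  have hF : Measurable F := by
    refine Measurable.mul (by fun_prop) (measurable_one.indicator ?_)
    exact measurableSet_lt measurable_const (by fun_prop)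
  have hoff : ∀ᵐ ω ∂μ, N.offset l ω ≠ 0 := by
    have := gaussian_ae_ne_zero hδ
    rw [← hN.offset_law l] at this
    exact ae_of_ae_map (hN.measurable_offset l).aemeasurable this
  calc _ = ∫⁻ ω, F (N.fading l l ω, Y ω) ∂μ := by
        refine lintegral_congr fun ω => ?_
        have hd : ‖N.txOf l ω - N.rxOf l ω‖ₑ = ‖N.offset l ω‖ₑ := by
          rw [rxOf, sub_add_cancel_left, enorm_neg]
        by_cases h : N.Active l ω ∧ N.rxOf l ω ∈ A
        · simp [F, Y, a, h, sinr, rxPower, hd, Set.indicator]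
        · simp [F, Y, a, h]
    _ = ∫⁻ ω, ∫⁻ h, F (h, Y ω) ∂(μ.map (N.fading l l)) ∂μ :=
        lintegral_comp_of_indepFun (hN.measurable_fading l l) hY hind hF
    _ = _ := by
        refine lintegral_congr_ae ?_
        filter_upwards [hoff] with ω hω
        rw [hN.fading_law]
        set c := N.interference P α l ω + ENNReal.ofReal noise with hc
        set r := ‖N.offset l ω‖ₑ with hr
        have hr0 : r ≠ 0 := by simpa [hr] using hω
        have hrt : r ≠ ∞ := enorm_ne_top
        have hr0' : r ^ α ≠ 0 := (ENNReal.rpow_pos (pos_iff_ne_zero.2 hr0) hrt).ne'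
        have hrt' : r ^ α ≠ ∞ := ENNReal.rpow_ne_top_of_ne_zero hr0 hrt
        have hP0 : ENNReal.ofReal P ≠ 0 := by simpa using hP
        -- Solving for the fading needs `0 < r < ∞`; since `0 < β < ∞`, the cases `c = 0` and `c =
        -- ∞` are covered too.
        have hset : {h : ℝ | ENNReal.ofReal β <
            ENNReal.ofReal P * ENNReal.ofReal h * r ^ (-α) / c} =
            {h | ENNReal.ofReal (β * P⁻¹) * r ^ α * c < ENNReal.ofReal h} := by
          ext h
          simp only [Set.mem_ofPred_eq]
          rw [ENNReal.lt_div_iff_mul_lt (Or.inr ENNReal.ofReal_ne_top)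
            (Or.inr (by simpa using hβ)), ENNReal.rpow_neg, ← div_eq_mul_inv,
            ENNReal.lt_div_iff_mul_lt (Or.inl hr0') (Or.inl hrt'), mul_comm (ENNReal.ofReal P),
            ← ENNReal.div_lt_iff (Or.inl hP0) (Or.inl ENNReal.ofReal_ne_top),
            ENNReal.ofReal_mul hβ.le, ENNReal.ofReal_inv_of_pos hP, div_eq_mul_inv]
          ring_nf
        have hFY : ∀ h, F (h, Y ω) = a ω * {h : ℝ | ENNReal.ofReal β <
            ENNReal.ofReal P * ENNReal.ofReal h * r ^ (-α) / c}.indicator 1 h := fun h => rfl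
        simp_rw [hFY, hset]
        have hm : MeasurableSet
            {h : ℝ | ENNReal.ofReal (β * P⁻¹) * r ^ α * c < ENNReal.ofReal h} :=
          measurableSet_lt measurable_const (by fun_prop)
        rw [lintegral_const_mul _ (measurable_one.indicator hm), lintegral_indicator_one hm,
          expMeasure_lt_ofReal]
        by_cases h : N.Active l ω ∧ N.rxOf l ω ∈ A <;> simp [a, h]

/-- The exponent of the mean of `exp (-s I)` that is contributed by the transmitter of the link
`k` at the receiver of the link `l`, if `x` are the locations of all transmitters and `z` is the
displacement of the receiver of `l`. -/
def linkExponent (pt pf : Fin M → ℝ) (P α : ℝ) (s : ℝ≥0∞) (k l : Link M) (x : Fin M → ℕ → Plane)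
    (z : Plane) : ℝ≥0∞ :=
  negLog (linkFactor (pt k.1 * pf k.1) α (s * ENNReal.ofReal P)
    ‖x k.1 k.2 - (x l.1 l.2 + z)‖ₑ)

open Classical in
/-- The conditional mean of `exp (-s I)` at an active link `l`, given all locations. -/
lemma IsModel.laplace_link (hN : N.IsModel lam pt pf δ μ)
    (hpt : ∀ i, pt i ∈ Set.Icc (0 : ℝ) 1) (hpf : ∀ i, pf i ∈ Set.Icc (0 : ℝ) 1)
    (P α : ℝ) {A : Set Plane} (hA : MeasurableSet A) {w s : Plane → ℝ≥0∞} (hw : Measurable w)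
    (hw1 : ∀ z, w z ≤ 1) (hs : Measurable s) (l : Link M) :
    ∫⁻ ω, (if N.Active l ω ∧ N.rxOf l ω ∈ A then
        w (N.offset l ω) * expNeg (s (N.offset l ω) * N.interference P α l ω) else 0) ∂μ =
      ∫⁻ ω, ENNReal.ofReal (pt l.1 * pf l.1) * (A.indicator 1 (N.rxOf l ω) * w (N.offset l ω)) *
        expNeg (∑' k : Link M, if k ≠ l then
          linkExponent pt pf P α (s (N.offset l ω)) k l (fun i n => N.tx i n ω) (N.offset l ω)
          else 0) ∂μ := by
  have hp : ∀ i, pt i * pf i ∈ Set.Icc (0 : ℝ) 1 := fun i =>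
    ⟨mul_nonneg (hpt i).1 (hpf i).1, mul_le_one₀ (hpt i).2 (hpf i).1 (hpf i).2⟩
  let R : Link M → Geometry M → ℝ≥0∞ := fun k t => ‖t.1 k.1 k.2 - (t.1 l.1 l.2 + t.2)‖ₑ
  have hR : ∀ k, Measurable (R k) := fun k => by
    refine Measurable.enorm (Measurable.sub ?_ (Measurable.add ?_ measurable_snd))
    · exact (measurable_pi_apply k.2).comp ((measurable_pi_apply k.1).comp measurable_fst)
    · exact (measurable_pi_apply l.2).comp ((measurable_pi_apply l.1).comp measurable_fst)
  let f : Geometry M → ℝ≥0∞ := fun t => A.indicator 1 (t.1 l.1 l.2 + t.2) * w t.2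
  have hf : Measurable f := by
    refine Measurable.mul ((measurable_one.indicator hA).comp (Measurable.add ?_ measurable_snd))
      (hw.comp measurable_snd)
    exact (measurable_pi_apply l.2).comp ((measurable_pi_apply l.1).comp measurable_fst)
  have hf1 : ∀ t, f t ≤ 1 := fun t => mul_le_one' (Set.indicator_le_self' (by simp) _) (hw1 _)
  have hftop : ∀ t, f t ≠ ∞ := fun t => ((hf1 t).trans_lt ENNReal.one_lt_top).ne
  let b : Link M → Geometry M → ℝ → ℝ≥0∞ := fun k t h =>
    s t.2 * ENNReal.ofReal P * R k t ^ (-α) * ENNReal.ofReal h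
  -- The link `l` carries its activity indicator, the others their share of `exp (-s I)`, so that a
  -- single product over links covers both.
  let φ : Link M → (Bool × Bool × ℝ) × Geometry M → ℝ≥0∞ := fun k q =>
    if k = l then (if q.1.1 = true ∧ q.1.2.1 = true then 1 else 0)
    else (if q.1.1 = true ∧ q.1.2.1 = true then expNeg (b k q.2 q.1.2.2) else 1)
  have hact : MeasurableSet {q : (Bool × Bool × ℝ) × Geometry M | q.1.1 = true ∧ q.1.2.1 = true} :=
    ((measurable_fst.comp measurable_fst) (measurableSet_singleton true)).inter
      ((measurable_fst.comp (measurable_snd.comp measurable_fst)) (measurableSet_singleton true))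
  have hφ : ∀ k, Measurable (φ k) := by
    intro k
    by_cases hk : k = l
    · simp only [φ, hk, if_true]
      exact Measurable.ite hact measurable_const measurable_const
    · simp only [φ, hk, if_false]
      refine Measurable.ite hact (measurable_expNeg.comp ?_) measurable_const
      have := hR k
      simp only [b]
      fun_prop
  have hφ1 : ∀ k q, φ k q ≤ 1 := by
    intro k q
    simp only [φ]
    split_ifs <;> simp [expNeg_le_one]
  let ψ : Link M → Geometry M → ℝ≥0∞ := fun k t =>
    if k = l then ENNReal.ofReal (pt l.1 * pf l.1)
    else expNeg (linkExponent pt pf P α (s t.2) k l t.1 t.2)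
  have hψ : ∀ k t, ∫⁻ x, φ k (x, t) ∂(μ.map (N.mark l k)) = ψ k t := by
    intro k t
    by_cases hk : k = l
    · subst hk
      have := isProbabilityMeasure_expMeasure one_pos
      simp only [φ, ψ, if_true]
      rw [hN.lintegral_mark hpt hpf k k (g := fun _ => 1) measurable_const 0]
      simp
    · simp only [φ, ψ, hk, if_false]
      rw [hN.lintegral_mark hpt hpf l k (g := fun h => expNeg (b k t h))
        (by simp only [b]; fun_prop) 1, linkExponent, expNeg_negLog (linkFactor_le_one (hp _) _ _)]
      simp only [b]
      rw [lintegral_expNeg_expMeasure, mul_one]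
      rfl
  have hτ := hN.measurable_geometry l
  have hψ1 : ∀ k t, ψ k t ≤ 1 := by
    intro k t
    simp only [ψ]
    split_ifs
    · exact ENNReal.ofReal_le_one.2 (hp _).2
    · exact expNeg_le_one _
  have hψm : ∀ k, Measurable (ψ k) := fun k => by
    rw [show ψ k = fun t => ∫⁻ x, φ k (x, t) ∂(μ.map (N.mark l k)) from
      funext fun t => (hψ k t).symm]
    have := Measure.isProbabilityMeasure_map (hN.measurable_mark l k).aemeasurable (μ := μ)
    exact (hφ k).lintegral_prod_left'
  have hL : Tendsto (fun F : Finset (Link M) => ∫⁻ ω, f (N.geometry l ω) *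
      ∏ k ∈ F, φ k (N.mark l k ω, N.geometry l ω) ∂μ) atTop (𝓝 (∫⁻ ω,
        (if N.Active l ω ∧ N.rxOf l ω ∈ A then
          w (N.offset l ω) * expNeg (s (N.offset l ω) * N.interference P α l ω) else 0) ∂μ)) := by
    -- Dominated convergence along finite sets of links is legitimate because there are countably
    -- many links.
    refine tendsto_lintegral_filter_of_dominated_convergence 1
      (Eventually.of_forall fun F => (hf.comp hτ).mul (Finset.measurable_prod _ fun k _ =>
        (hφ k).comp ((hN.measurable_mark l k).prodMk hτ)))
      (Eventually.of_forall fun F => Eventually.of_forall fun ω =>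
        mul_le_one' (hf1 _) (Finset.prod_le_one' fun k _ => hφ1 _ _)) (by simp)
      (Eventually.of_forall fun ω => ?_)
    have h := tendsto_mul_prod_expNeg l (hftop (N.geometry l ω))
      (c := if N.Active l ω then 1 else 0) (by split_ifs <;> simp)
      (fun k => if N.Active k ω then b k (N.geometry l ω) (N.fading k l ω) else 0)
    convert h using 2
    · congr 1
      refine Finset.prod_congr rfl fun k _ => ?_
      by_cases hk : k = l
      · subst hk
        by_cases ha : N.Active k ω <;> have ha' := ha <;> unfold Active at ha' <;>
          simp [φ, mark, ha, ha']
      · by_cases ha : N.Active k ω <;> have ha' := ha <;> unfold Active at ha' <;>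
          simp [φ, mark, hk, ha, ha']
    · have hI : s (N.offset l ω) * N.interference P α l ω = ∑' k, if k ≠ l then
          (if N.Active k ω then b k (N.geometry l ω) (N.fading k l ω) else 0) else 0 := by
        rw [interference, ← ENNReal.tsum_mul_left]
        refine tsum_congr fun k => ?_
        by_cases hk : k = l
        · simp [hk]
        · by_cases ha : N.Active k ω
          · simp only [ne_eq, hk, not_false_eq_true, ha, and_self, if_true, rxPower, b, R, geometry,
              rxOf, txOf]
            ring
          · simp [ha]
      rw [← hI]
      by_cases ha : N.Active l ω <;> by_cases hr : N.rxOf l ω ∈ A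
      · have hr' : N.tx l.1 l.2 ω + N.offset l ω ∈ A := hr
        simp [ha, hr, f, geometry, hr']
      · have hr' : N.tx l.1 l.2 ω + N.offset l ω ∉ A := hr
        simp [ha, hr, f, geometry, hr']
      · simp [ha]
      · simp [ha]
  have hR : Tendsto (fun F : Finset (Link M) => ∫⁻ ω, f (N.geometry l ω) *
      ∏ k ∈ F, ψ k (N.geometry l ω) ∂μ) atTop (𝓝 (∫⁻ ω,
        ENNReal.ofReal (pt l.1 * pf l.1) * (A.indicator 1 (N.rxOf l ω) * w (N.offset l ω)) *
        expNeg (∑' k : Link M, if k ≠ l then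
          linkExponent pt pf P α (s (N.offset l ω)) k l (fun i n => N.tx i n ω) (N.offset l ω)
          else 0) ∂μ)) := by
    refine tendsto_lintegral_filter_of_dominated_convergence 1
      (Eventually.of_forall fun F => (hf.comp hτ).mul (Finset.measurable_prod _ fun k _ =>
        (hψm k).comp hτ))
      (Eventually.of_forall fun F => Eventually.of_forall fun ω =>
        mul_le_one' (hf1 _) (Finset.prod_le_one' fun k _ => hψ1 _ _)) (by simp)
      (Eventually.of_forall fun ω => ?_)
    exact tendsto_mul_prod_expNeg l (hftop (N.geometry l ω)) ENNReal.ofReal_ne_top _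
  refine tendsto_nhds_unique hL (hR.congr fun F => ?_)
  have := lintegral_prod_of_indep_marks hτ (hN.measurable_mark l) (hN.indepFun_mark l) hφ F hf
  rw [this]
  simp_rw [hψ]

end Network

/-! ### Means of sums over the links in a window -/

namespace Network

variable {M : ℕ} {Ω : Type*} [mΩ : MeasurableSpace Ω] {μ : Measure Ω}
  {N : Network M Ω} {lam pt pf : Fin M → ℝ} {δ : ℝ}

lemma IsModel.measurable_interference_of_isModel (hN : N.IsModel lam pt pf δ μ) (P α : ℝ)
    (l : Link M) : Measurable (N.interference P α l) :=
  measurable_interference P α hN.measurable_tx hN.measurable_timeHop hN.measurable_freqHop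
    (hN.measurable_offset l) fun k _ => hN.measurable_fading k l

open Classical in
lemma IsModel.lintegral_windowSum_eq_tsum (hN : N.IsModel lam pt pf δ μ) {A : Set Plane}
    (hA : MeasurableSet A) {Z : Link M → Ω → ℝ≥0∞} (hZ : ∀ l, Measurable (Z l)) :
    ∫⁻ ω, N.windowSum A Z ω ∂μ =
      ∑' l, ∫⁻ ω, (if N.Active l ω ∧ N.rxOf l ω ∈ A then Z l ω else 0) ∂μ :=
  lintegral_tsum fun l => (Measurable.ite (measurableSet_active_window (hN.measurable_tx l)
    (hN.measurable_timeHop l) (hN.measurable_freqHop l) (hN.measurable_offset l) hA) (hZ l)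
    measurable_const).aemeasurable

variable [IsProbabilityMeasure μ]

open Classical in
/-- The mean of the window sum of `w * exp (-s I)`, where `w` and `s` may depend on the displacement
of the receiver from its transmitter. -/
lemma IsModel.lintegral_windowSum (hN : N.IsModel lam pt pf δ μ) (hδ : 0 < δ)
    (hpt : ∀ i, pt i ∈ Set.Icc (0 : ℝ) 1) (hpf : ∀ i, pf i ∈ Set.Icc (0 : ℝ) 1)
    {P α : ℝ} (hα : 0 < α) {A : Set Plane} (hA : MeasurableSet A) (hA' : volume A ≠ ∞)
    {w s : Plane → ℝ≥0∞} (hw : Measurable w) (hw1 : ∀ z, w z ≤ 1) (hs : Measurable s)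
    (hs' : ∀ z, s z ≠ ∞) :
    ∫⁻ ω, N.windowSum A (fun l ω => w (N.offset l ω) *
        expNeg (s (N.offset l ω) * N.interference P α l ω)) ω ∂μ =
      (∑ i, ENNReal.ofReal (lam i) * ENNReal.ofReal (pt i * pf i)) * volume A *
        ∫⁻ z, w z * expNeg (∑ j, ENNReal.ofReal (lam j) * ∫⁻ y : Plane,
          1 - linkFactor (pt j * pf j) α (s z * ENNReal.ofReal P) ‖y‖ₑ)
          ∂((stdGaussian Plane).map fun x => δ • x) := by
  have hp : ∀ i, pt i * pf i ∈ Set.Icc (0 : ℝ) 1 := fun i =>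
    ⟨mul_nonneg (hpt i).1 (hpf i).1, mul_le_one₀ (hpt i).2 (hpf i).1 (hpf i).2⟩
  set γ := (stdGaussian Plane).map fun x => δ • x with hγ
  have : IsProbabilityMeasure γ :=
    Measure.isProbabilityMeasure_map (by fun_prop : Measurable _).aemeasurable
  have hoffset : ∀ l, Measurable (N.offset l) := hN.measurable_offset
  have hI := hN.measurable_interference_of_isModel P α
  let Ψ : Link M → Plane × (Fin M → ℕ → Plane) → ℝ≥0∞ := fun l q =>
    ENNReal.ofReal (pt l.1 * pf l.1) * (A.indicator 1 (q.2 l.1 l.2 + q.1) * w q.1) *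
      expNeg (∑' k : Link M, if k ≠ l then linkExponent pt pf P α (s q.1) k l q.2 q.1 else 0)
  have hev : ∀ k : Link M, Measurable fun q : Plane × (Fin M → ℕ → Plane) => q.2 k.1 k.2 :=
    fun k => (measurable_pi_apply k.2).comp ((measurable_pi_apply k.1).comp measurable_snd)
  have hΨ : ∀ l, Measurable (Ψ l) := by
    intro l
    refine Measurable.mul (Measurable.const_mul (Measurable.mul ?_ (hw.comp measurable_fst)) _)
      (measurable_expNeg.comp (Measurable.tsum fun k => ?_))
    · exact (measurable_one.indicator hA).comp ((hev l).add measurable_fst)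
    · by_cases hk : k = l
      · simp [hk]
      · have h1 := hev k
        have h2 := hev l
        simp only [ne_eq, hk, not_false_eq_true, if_true, linkExponent, linkFactor]
        fun_prop
  have hX : Measurable fun ω i n => N.tx i n ω := measurable_pi_lambda _ hN.measurable_points
  have hlink : ∀ l, ∫⁻ ω, (if N.Active l ω ∧ N.rxOf l ω ∈ A then
        w (N.offset l ω) * expNeg (s (N.offset l ω) * N.interference P α l ω) else 0) ∂μ =
      ∫⁻ z, ∫⁻ ω, Ψ l (z, fun i n => N.tx i n ω) ∂μ ∂γ := by
    intro l
    -- The displacement is independent of all transmitter locations, so it can be frozen at `z` and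
    -- averaged last.
    have hind : IndepFun (N.offset l) (fun ω i n => N.tx i n ω) μ := by
      refine hN.indepFun_of_disjoint (S := {.offset l}) (T := Set.range Source.points) (by simp)
        (measurable_sigmaOf_offset (by simp)) ?_
      exact @measurable_pi_lambda _ _ _ (N.sigmaOf (Set.range Source.points)) _ _ fun i =>
        measurable_sigmaOf_points (by simp)
    have h := lintegral_comp_of_indepFun (hoffset l) hX hind (hΨ l)
    rw [hN.offset_law, ← hγ] at h
    rw [hN.laplace_link hpt hpf P α hA hw hw1 hs l]
    refine h.trans (lintegral_lintegral_swap (μ := μ) (ν := γ)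
      (f := fun ω z => Ψ l (z, fun i n => N.tx i n ω)) ?_)
    exact ((hΨ l).comp (measurable_snd.prodMk (hX.comp measurable_fst))).aemeasurable
  have hΨX : ∀ l z, Measurable fun ω => Ψ l (z, fun i n => N.tx i n ω) := fun l z =>
    (hΨ l).comp (measurable_const.prodMk hX)
  have hΨint : ∀ l, Measurable fun z => ∫⁻ ω, Ψ l (z, fun i n => N.tx i n ω) ∂μ := fun l =>
    ((hΨ l).comp (measurable_fst.prodMk (hX.comp measurable_snd))).lintegral_prod_right'
  have hZ : ∀ l, Measurable fun ω => w (N.offset l ω) *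
      expNeg (s (N.offset l ω) * N.interference P α l ω) := fun l =>
    (hw.comp (hoffset l)).mul (measurable_expNeg.comp ((hs.comp (hoffset l)).mul (hI l)))
  rw [hN.lintegral_windowSum_eq_tsum hA hZ]
  simp_rw [hlink]
  rw [← lintegral_tsum fun l => (hΨint l).aemeasurable,
    ← lintegral_const_mul' _ _ (ENNReal.mul_ne_top
      (ENNReal.sum_lt_top.2 fun i _ => ENNReal.mul_lt_top ENNReal.ofReal_lt_top
        ENNReal.ofReal_lt_top).ne hA')]
  refine lintegral_congr_ae ?_
  -- For `z ≠ 0` the exponent of the link's own transmitter is finite, the condition for removing it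
  -- in `mecke_removed`.
  filter_upwards [gaussian_ae_ne_zero hδ] with z hz
  have hsP : s z * ENNReal.ofReal P ≠ ∞ := ENNReal.mul_ne_top (hs' z) ENNReal.ofReal_ne_top
  let v : Fin M → ℝ≥0∞ → ℝ≥0∞ := fun i d =>
    negLog (linkFactor (pt i * pf i) α (s z * ENNReal.ofReal P) d)
  have hv : ∀ i d, expNeg (v i d) = linkFactor (pt i * pf i) α (s z * ENNReal.ofReal P) d :=
    fun i d => expNeg_negLog (linkFactor_le_one (hp i) _ _)
  have key := hN.mecke_removed hA hA' (p := fun i => ENNReal.ofReal (pt i * pf i) * w z)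
    (fun i => ENNReal.mul_ne_top ENNReal.ofReal_ne_top ((hw1 z).trans_lt ENNReal.one_lt_top).ne)
    (v := v) (fun i => negLog_antitone.comp_monotone (linkFactor_monotone hα.le _))
    (fun i => continuous_negLog.comp (continuous_linkFactor hsP)) (z := z)
    (fun i => negLog_ne_top (linkFactor_ne_zero hα hsP (by simpa using hz)))
  simp_rw [hv] at key
  rw [← lintegral_tsum fun l => (hΨX l z).aemeasurable]
  refine Eq.trans (lintegral_congr fun ω => tsum_congr fun l => ?_) (key.trans ?_)
  · simp only [Ψ, v, linkExponent, txOf]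
    rw [← mul_assoc, mul_right_comm _ _ (w z)]
  · simp_rw [← mul_assoc]
    rw [← Finset.sum_mul]
    ring

end Network

/-! ### Explicit evaluation at the typical link -/

lemma sin_two_pi_div_pos {α : ℝ} (hα : 2 < α) : 0 < Real.sin (2 * Real.pi / α) := by
  have hα0 : 0 < α := by linarith
  refine Real.sin_pos_of_pos_of_lt_pi (by positivity) ?_
  rw [div_lt_iff₀ hα0]
  nlinarith [Real.pi_pos]

namespace Network

variable {M : ℕ} {Ω : Type*} [mΩ : MeasurableSpace Ω] {μ : Measure Ω} [IsProbabilityMeasure μ]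
  {N : Network M Ω} {lam pt pf : Fin M → ℝ} {δ P α : ℝ} {A : Set Plane}

lemma expNeg_sum_linkFactor (hlam : ∀ i, 0 ≤ lam i) (hpt : ∀ i, pt i ∈ Set.Icc (0 : ℝ) 1)
    (hpf : ∀ i, pf i ∈ Set.Icc (0 : ℝ) 1) (hα : 2 < α) {t : ℝ} (ht : 0 ≤ t) :
    expNeg (∑ j, ENNReal.ofReal (lam j) * ∫⁻ y : Plane,
        1 - linkFactor (pt j * pf j) α (ENNReal.ofReal t) ‖y‖ₑ) =
      ENNReal.ofReal (Real.exp (-((∑ i, pt i * pf i * lam i) *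
        ((2 * Real.pi ^ 2 / α) / Real.sin (2 * Real.pi / α)) * t ^ (2 / α)))) := by
  have hp : ∀ i, pt i * pf i ∈ Set.Icc (0 : ℝ) 1 := fun i =>
    ⟨mul_nonneg (hpt i).1 (hpf i).1, mul_le_one₀ (hpt i).2 (hpf i).1 (hpf i).2⟩
  have hsin := sin_two_pi_div_pos hα
  have hα0 : 0 < α := by linarith
  set κ := (2 * Real.pi ^ 2 / α) / Real.sin (2 * Real.pi / α)
  have hκ : 0 ≤ κ := by positivity
  have hnn : ∀ i ∈ Finset.univ, 0 ≤ lam i * (pt i * pf i * κ * t ^ (2 / α)) := fun i _ =>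
    mul_nonneg (hlam i) (mul_nonneg (mul_nonneg (hp i).1 hκ) (by positivity))
  have hterm : ∀ j, ENNReal.ofReal (lam j) * ∫⁻ y : Plane,
      1 - linkFactor (pt j * pf j) α (ENNReal.ofReal t) ‖y‖ₑ =
      ENNReal.ofReal (lam j * (pt j * pf j * κ * t ^ (2 / α))) := fun j => by
    rw [lintegral_one_sub_linkFactor (hp j) hα ht, ENNReal.ofReal_mul (hlam j)]
  simp_rw [hterm]
  rw [← ENNReal.ofReal_sum_of_nonneg hnn, expNeg_ofReal (Finset.sum_nonneg hnn), Finset.sum_mul,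
    Finset.sum_mul]
  congr 3
  exact Finset.sum_congr rfl fun i _ => by ring

/-- The denominator is the same window mean with `w = 1` and `s = 0`. The common factor, density of
active links times area of `A`, is positive and finite and cancels. -/
lemma IsModel.typicalMean_eq (hN : N.IsModel lam pt pf δ μ) (hδ : 0 < δ)
    (hlam : ∀ i, 0 ≤ lam i) (hpt : ∀ i, pt i ∈ Set.Icc (0 : ℝ) 1)
    (hpf : ∀ i, pf i ∈ Set.Icc (0 : ℝ) 1) (hactive : 0 < ∑ i, pt i * pf i * lam i) (hP : 0 ≤ P)
    (hα : 2 < α) (hA : MeasurableSet A) (hA0 : volume A ≠ 0) (hA1 : volume A ≠ ∞)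
    {w : Plane → ℝ≥0∞} {s : Plane → ℝ} (hw : Measurable w) (hw1 : ∀ z, w z ≤ 1)
    (hs : Measurable s) (hs' : ∀ z, 0 ≤ s z) :
    N.typicalMean μ A (fun l ω => w (N.offset l ω) *
        expNeg (ENNReal.ofReal (s (N.offset l ω)) * N.interference P α l ω)) =
      ∫⁻ z, w z * ENNReal.ofReal (Real.exp (-((∑ i, pt i * pf i * lam i) *
        ((2 * Real.pi ^ 2 / α) / Real.sin (2 * Real.pi / α)) * (s z * P) ^ (2 / α))))
          ∂((stdGaussian Plane).map fun x => δ • x) := by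
  have hα0 : 0 < α := by linarith
  have h2α0 : 0 < 2 / α := by positivity
  have hγ : IsProbabilityMeasure ((stdGaussian Plane).map fun x => δ • x) :=
    Measure.isProbabilityMeasure_map (by fun_prop : Measurable _).aemeasurable
  have hgen : ∀ {w : Plane → ℝ≥0∞} {s : Plane → ℝ}, Measurable w → (∀ z, w z ≤ 1) →
      Measurable s → (∀ z, 0 ≤ s z) → _ := fun hw hw1 (hs : Measurable _) hs' =>
    hN.lintegral_windowSum (P := P) hδ hpt hpf hα0 hA hA1 hw hw1 hs.ennreal_ofReal
      fun _ => ENNReal.ofReal_ne_top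
  have hnum := hgen hw hw1 hs hs'
  have hden := hgen (w := fun _ => 1) (s := fun _ => 0) measurable_const (fun _ => le_rfl)
    measurable_const fun _ => le_rfl
  simp_rw [← ENNReal.ofReal_mul (hs' _), fun z => expNeg_sum_linkFactor hlam hpt hpf hα
    (mul_nonneg (hs' z) hP)] at hnum
  have h0 := expNeg_sum_linkFactor hlam hpt hpf hα le_rfl
  rw [Real.zero_rpow h2α0.ne', mul_zero, neg_zero, Real.exp_zero, ENNReal.ofReal_one,
    ENNReal.ofReal_zero] at h0
  simp only [ENNReal.ofReal_zero, zero_mul, expNeg_zero, mul_one, h0, lintegral_const,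
    measure_univ] at hden
  have hT : ∑ i, ENNReal.ofReal (lam i) * ENNReal.ofReal (pt i * pf i) =
      ENNReal.ofReal (∑ i, pt i * pf i * lam i) := by
    rw [ENNReal.ofReal_sum_of_nonneg fun i _ =>
      mul_nonneg (mul_nonneg (hpt i).1 (hpf i).1) (hlam i)]
    exact Finset.sum_congr rfl fun i _ => by rw [← ENNReal.ofReal_mul (hlam i), mul_comm]
  rw [hT] at hnum hden
  have hT0 : ENNReal.ofReal (∑ i, pt i * pf i * lam i) ≠ 0 := by simpa using hactive
  rw [typicalMean, hden, hnum, mul_comm (_ * volume A)]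
  exact ENNReal.mul_div_cancel_right (mul_ne_zero hT0 hA0)
    (ENNReal.mul_ne_top ENNReal.ofReal_ne_top hA1)

lemma IsModel.interferenceLaplace_eq (hN : N.IsModel lam pt pf δ μ) (hδ : 0 < δ)
    (hlam : ∀ i, 0 ≤ lam i) (hpt : ∀ i, pt i ∈ Set.Icc (0 : ℝ) 1)
    (hpf : ∀ i, pf i ∈ Set.Icc (0 : ℝ) 1) (hactive : 0 < ∑ i, pt i * pf i * lam i) (hP : 0 ≤ P)
    (hα : 2 < α) (hA : MeasurableSet A) (hA0 : volume A ≠ 0) (hA1 : volume A ≠ ∞)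
    {s : ℝ} (hs : 0 ≤ s) :
    N.interferenceLaplace μ A P α s =
      ENNReal.ofReal (Real.exp (-((∑ i, pt i * pf i * lam i) *
        ((2 * Real.pi ^ 2 / α) / Real.sin (2 * Real.pi / α)) * (s * P) ^ (2 / α)))) := by
  have hγ : IsProbabilityMeasure ((stdGaussian Plane).map fun x => δ • x) :=
    Measure.isProbabilityMeasure_map (by fun_prop : Measurable _).aemeasurable
  have h := hN.typicalMean_eq hδ hlam hpt hpf hactive hP hα hA hA0 hA1 (w := fun _ => 1)
    (s := fun _ => s) measurable_const (fun _ => le_rfl) measurable_const fun _ => hs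
  simp only [one_mul, lintegral_const, measure_univ, mul_one] at h
  exact h

lemma IsModel.coverageProb_eq (hN : N.IsModel lam pt pf δ μ) (hδ : 0 < δ)
    (hlam : ∀ i, 0 ≤ lam i) (hpt : ∀ i, pt i ∈ Set.Icc (0 : ℝ) 1)
    (hpf : ∀ i, pf i ∈ Set.Icc (0 : ℝ) 1) (hactive : 0 < ∑ i, pt i * pf i * lam i) (hP : 0 < P)
    (hα : 2 < α) {noise : ℝ} (hnoise : 0 ≤ noise)
    (hA : MeasurableSet A) (hA0 : volume A ≠ 0) (hA1 : volume A ≠ ∞) {β : ℝ} (hβ : 0 < β) :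
    N.coverageProb μ A P α noise β =
      ∫⁻ v in Set.Ioi (0 : ℝ), ENNReal.ofReal (Real.exp (-(β * P⁻¹ * noise * v ^ α))) *
        N.interferenceLaplace μ A P α (β * P⁻¹ * v ^ α) *
        ENNReal.ofReal (v * Real.exp (-(v ^ 2 / (2 * δ ^ 2))) / δ ^ 2) := by
  classical
  have hα0 : 0 < α := by linarith
  have hI := hN.measurable_interference_of_isModel P α
  have hoff := hN.measurable_offset
  let s : Plane → ℝ := fun z => β * P⁻¹ * ‖z‖ ^ α
  have hs : Measurable s := by fun_prop
  have hs0 : ∀ z, 0 ≤ s z := fun z => by positivity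
  let w : Plane → ℝ≥0∞ := fun z => ENNReal.ofReal (Real.exp (-(s z * noise)))
  have hw : Measurable w := by fun_prop
  have hwexp : ∀ z, w z = expNeg (ENNReal.ofReal (s z) * ENNReal.ofReal noise) := fun z => by
    rw [← ENNReal.ofReal_mul (hs0 z), expNeg_ofReal (mul_nonneg (hs0 z) hnoise)]
  have hsinr : ∀ l, Measurable (N.sinr P α noise l) := by
    intro l
    have h1 := hN.measurable_tx l
    have h2 := hoff l
    have h3 := hN.measurable_fading l l
    have h4 := hI l
    unfold sinr rxPower rxOf
    fun_prop
  -- The averaged indicator `exp (-s (I + noise))` splits into `w`, which depends on the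
  -- displacement only, and `exp (-s I)`.
  have hwin : ∫⁻ ω, N.windowSum A (fun l ω => if ENNReal.ofReal β < N.sinr P α noise l ω
        then 1 else 0) ω ∂μ =
      ∫⁻ ω, N.windowSum A (fun l ω => w (N.offset l ω) *
        expNeg (ENNReal.ofReal (s (N.offset l ω)) * N.interference P α l ω)) ω ∂μ := by
    have hZ : ∀ l, Measurable fun ω => w (N.offset l ω) *
        expNeg (ENNReal.ofReal (s (N.offset l ω)) * N.interference P α l ω) := fun l =>
      (hw.comp (hoff l)).mul
        (measurable_expNeg.comp (((hs.comp (hoff l)).ennreal_ofReal).mul (hI l)))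
    rw [hN.lintegral_windowSum_eq_tsum hA fun l => Measurable.ite
        (measurableSet_lt measurable_const (hsinr l)) measurable_const measurable_const,
      hN.lintegral_windowSum_eq_tsum hA hZ]
    refine tsum_congr fun l => (hN.coverage_link hδ hP hβ noise hA l).trans ?_
    refine lintegral_congr fun ω => ?_
    rw [hwexp, ← expNeg_add, ← mul_add, add_comm (ENNReal.ofReal noise)]
    have : ENNReal.ofReal (β * P⁻¹) * ‖N.offset l ω‖ₑ ^ α = ENNReal.ofReal (s (N.offset l ω)) := by
      rw [← ofReal_norm, ENNReal.ofReal_rpow_of_nonneg (norm_nonneg _) hα0.le,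
        ← ENNReal.ofReal_mul (by positivity)]
    rw [this]
  have h := hN.typicalMean_eq hδ hlam hpt hpf hactive hP.le hα hA hA0 hA1 hw
    (fun z => by rw [hwexp]; exact expNeg_le_one _) hs hs0
  rw [typicalMean, ← hwin] at h
  refine Eq.trans ?_ (h.trans ?_)
  · unfold coverageProb typicalMean
    congr!
  · rw [lintegral_norm_gaussian hδ (f := fun v =>
      ENNReal.ofReal (Real.exp (-(β * P⁻¹ * v ^ α * noise))) *
      ENNReal.ofReal (Real.exp (-((∑ i, pt i * pf i * lam i) *
        ((2 * Real.pi ^ 2 / α) / Real.sin (2 * Real.pi / α)) *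
          (β * P⁻¹ * v ^ α * P) ^ (2 / α))))) (by fun_prop)]
    refine setLIntegral_congr_fun measurableSet_Ioi fun v hv => ?_
    have hv : 0 < v := hv
    rw [hN.interferenceLaplace_eq hδ hlam hpt hpf hactive hP.le hα hA hA0 hA1 (by positivity),
      mul_right_comm (β * P⁻¹) noise]

end Network

end D2D

end

theorem mainTheorem3 {M : ℕ} {Ω : Type*} [MeasurableSpace Ω] (μ : Measure Ω)
    [IsProbabilityMeasure μ] (N : D2D.Network M Ω) (lam pt pf : Fin M → ℝ) (δ P α noise : ℝ)
    (hlam : ∀ i, 0 < lam i) (hpt : ∀ i, pt i ∈ Set.Icc (0 : ℝ) 1)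
    (hpf : ∀ i, pf i ∈ Set.Icc (0 : ℝ) 1) (hδ : 0 < δ) (hP : 0 < P) (hα : 2 < α)
    (hnoise : 0 ≤ noise) (hactive : 0 < ∑ i, pt i * pf i * lam i)
    (hN : N.IsModel lam pt pf δ μ)
    (A : Set D2D.Plane) (hA : MeasurableSet A) (hA0 : volume A ≠ 0) (hA1 : volume A ≠ ∞) :
    (∀ β : ℝ, 0 < β →
      N.coverageProb μ A P α noise β =
        ∫⁻ v in Set.Ioi (0 : ℝ),
          ENNReal.ofReal (Real.exp (-(β * P⁻¹ * noise * v ^ α))) *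
            N.interferenceLaplace μ A P α (β * P⁻¹ * v ^ α) *
            ENNReal.ofReal (v * Real.exp (-(v ^ 2 / (2 * δ ^ 2))) / δ ^ 2)) ∧
    (∀ s : ℝ, 0 ≤ s →
      N.interferenceLaplace μ A P α s =
        ENNReal.ofReal (Real.exp (-((∑ i, pt i * pf i * lam i) *
          ((2 * Real.pi ^ 2 / α) / Real.sin (2 * Real.pi / α)) * (s * P) ^ (2 / α))))) :=
  ⟨fun _ hβ => hN.coverageProb_eq hδ (fun i => (hlam i).le) hpt hpf hactive hP hα hnoise hA hA0 hA1
    hβ,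
  fun _ hs => hN.interferenceLaplace_eq hδ (fun i => (hlam i).le) hpt hpf hactive hP.le hα hA hA0
    hA1 hs⟩
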